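/- Let $S\subset\mathbb{R}$ be a finite union of bounded intervals (each of which may be open, closed or half-open, and possibly degenerate). Then there exists a set $\Lambda\subset\mathbb{R}$ such that the system of exponentials $\{e^{i\lambda t}\}_{\lambda\in\Lambda}$ is a Riesz basis of $L^2(S)$ (the space of complex-valued functions that are square integrable on $S$ with respect to Lebesgue measure). Moreover, if $S\subseteq[0,2\pi]$, then $\Lambda$ may be chosen to satisfy $\Lambda\subseteq\mathbb{Z}$. Here a system of vectors in a Hilbert space $H$ is called a Riesz basis of $H$ if it is the image of an orthonormal basis of $H$ under a bounded invertible operator $H\to H$. If $S$ has measure zero, then $L^2(S)=\{0\}$, and the empty system counts as its orthonormal basis and as its Riesz basis. -/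

import Mathlib

/-- A system of vectors `f` in a complex Hilbert space `H` is a *Riesz basis* if it is the image of
an orthonormal (Hilbert) basis under a bounded invertible operator of `H`. -/
def IsRieszBasis {ι H : Type*} [NormedAddCommGroup H] [InnerProductSpace ℂ H]
    (f : ι → H) : Prop :=
  ∃ (b : HilbertBasis ι ℂ H) (T : H ≃L[ℂ] H), ∀ i, f i = T (b i)

/-- The exponentials `t ↦ e^{iλt}`, `λ ∈ Λ`, belong to `L²(S)` (complex valued, with respect to
Lebesgue measure on `S`), and the system of their classes, indexed by the set `Λ`, is a Riesz basis
of `L²(S)`. -/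
def IsExpRieszBasis (Λ S : Set ℝ) : Prop :=
  ∃ e : Λ → MeasureTheory.Lp ℂ 2 (MeasureTheory.volume.restrict S),
    (∀ l : Λ, e l =ᵐ[MeasureTheory.volume.restrict S]
      fun t : ℝ => Complex.exp (Complex.I * ((l : ℝ) : ℂ) * (t : ℂ))) ∧
    IsRieszBasis e

/-- `S` is the union of finitely many bounded intervals. Order-connected subsets of `ℝ` are exactly
the intervals: open, closed or half-open, one-point or empty. -/
def IsFiniteUnionOfIntervals (S : Set ℝ) : Prop :=
  ∃ (n : ℕ) (J : Fin n → Set ℝ),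
    (∀ i, (J i).OrdConnected ∧ Bornology.IsBounded (J i)) ∧ S = ⋃ i, J i

/-!
Work on the circle `ℝ / ℤ` with integer frequencies, and fold it by `x ↦ N x`. For a set `S`, let
`S_n` be the set of points whose fibre under the folding meets `S` in more than `n` points. If every
`S_n`, `n < N`, has a Riesz spectrum `Λ_n`, then `⋃ n < N, (N Λ_n + n)` is one for `S`: along a
fibre, the restriction to `S` of a sum with these frequencies is the restriction of a polynomial to
the nodes in `S`, and Lagrange interpolation recovers its coefficients one at a time.

The number of points of `S` in a fibre is a step function with at most as many jumps as `S`, and its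
superlevel sets are the `S_n`. Hence the induction on the number of arcs works as soon as some `N`
makes every `S_n` simpler than `S`. If there were no such `N`, the counting function would take only
two consecutive values for every `N`; Bessel's inequality would then bound the Fourier transform of
its jumps at the frequencies `1` and `2`, and these bounds are too strong for the mean square over
`N` of the exponential sum formed with the jumps of `S`. There remains a single arc, which
Dirichlet's approximation theorem makes short by a further folding; on an arc of length `δ` at most
`1 / 4` the frequencies `round (k / δ)` are a Paley–Wiener perturbation of an orthogonal basis.
Polar decomposition turns the isomorphism between functions with spectrum in `Λ` and `L²(S)` into a
Riesz basis in the required sense.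
-/

open MeasureTheory AddCircle Set Filter
open scoped ENNReal NNReal FourierTransform

/-! ### Sections and inverse branches of the circle -/

/-- The representative in `(a, a + 1]` of a point of the circle. -/
noncomputable def circleRep (a : ℝ) (y : UnitAddCircle) : ℝ := (equivIoc (1 : ℝ) a y : ℝ)

@[simp]
lemma coe_circleRep (a : ℝ) (y : UnitAddCircle) : ((circleRep a y : ℝ) : UnitAddCircle) = y :=
  (equivIoc (1 : ℝ) a).symm_apply_apply y

lemma circleRep_mem_Ioc (a : ℝ) (y : UnitAddCircle) : circleRep a y ∈ Ioc a (a + 1) :=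
  (equivIoc (1 : ℝ) a y).2

lemma circleRep_coe {a t : ℝ} (ht : t ∈ Ioc a (a + 1)) :
    circleRep a (t : UnitAddCircle) = t := by
  rw [circleRep, equivIoc_coe_eq ht]

lemma measurableEmbedding_circleRep (a : ℝ) : MeasurableEmbedding (circleRep a) :=
  (MeasurableEmbedding.subtype_coe measurableSet_Ioc).comp
    (measurableEquivIoc (1 : ℝ) a).measurableEmbedding

lemma haarAddCircle_eq_volume : (haarAddCircle : Measure UnitAddCircle) = volume := by
  simp [volume_eq_smul_haarAddCircle]

lemma map_circleRep (a : ℝ) :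
    Measure.map (circleRep a) haarAddCircle = volume.restrict (Ioc a (a + 1)) := by
  have hmap := (measurePreserving_equivIoc (1 : ℝ) (a := a)).map_eq
  rw [haarAddCircle_eq_volume, show circleRep a = Subtype.val ∘ equivIoc (1 : ℝ) a from rfl,
    ← Measure.map_map measurable_subtype_coe
      (show Measurable (equivIoc (1 : ℝ) a) from (measurableEquivIoc (1 : ℝ) a).measurable), hmap,
    (MeasurableEmbedding.subtype_coe measurableSet_Ioc).map_comap, Subtype.range_coe]

lemma ae_circleRep_iff (a : ℝ) {P : ℝ → Prop} :
    (∀ᵐ y ∂(haarAddCircle : Measure UnitAddCircle), P (circleRep a y)) ↔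
      ∀ᵐ t : ℝ, t ∈ Ioc a (a + 1) → P t := by
  rw [← (measurableEmbedding_circleRep a).ae_map_iff, map_circleRep,
    ae_restrict_iff' measurableSet_Ioc]

lemma ae_circle_iff_Ioc (a : ℝ) {P : UnitAddCircle → Prop} :
    (∀ᵐ y ∂(haarAddCircle : Measure UnitAddCircle), P y) ↔
      ∀ᵐ t : ℝ, t ∈ Ioc a (a + 1) → P t := by
  rw [← ae_circleRep_iff a (P := fun t => P t)]
  simp

lemma ae_circle_iff {P : UnitAddCircle → Prop} :
    (∀ᵐ y ∂(haarAddCircle : Measure UnitAddCircle), P y) ↔ ∀ᵐ t : ℝ, P t := by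
  refine ⟨fun h => ?_, fun h => (ae_circle_iff_Ioc 0).2 (h.mono fun t ht _ => ht)⟩
  have hperiods : ∀ᵐ t : ℝ, ∀ n : ℤ, t ∈ Ioc (n : ℝ) (n + 1) → P t :=
    ae_all_iff.2 fun n => (ae_circle_iff_Ioc n).1 h
  filter_upwards [hperiods] with t ht
  refine ht (⌈t⌉ - 1) ⟨?_, ?_⟩ <;> push_cast
  · linarith [Int.ceil_lt_add_one t]
  · linarith [Int.le_ceil t]

lemma ae_comp_affine_iff {r : ℝ} (hr : r ≠ 0) (p : ℝ) {P : ℝ → Prop} :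
    (∀ᵐ t : ℝ, P (p + r * t)) ↔ ∀ᵐ t : ℝ, P t := by
  have hemb : MeasurableEmbedding fun t : ℝ => p + r * t :=
    (measurableEmbedding_addLeft p).comp (measurableEmbedding_mulLeft₀ hr)
  have hmap : Measure.map (fun t : ℝ => p + r * t) volume = ENNReal.ofReal |r⁻¹| • volume := by
    rw [show (fun t : ℝ => p + r * t) = (fun t => p + t) ∘ (fun t => r * t) from rfl,
      ← Measure.map_map (measurable_const_add p) (measurable_const_mul r),
      Real.map_volume_mul_left hr, Measure.map_smul, map_add_left_eq_self]
  rw [← hemb.ae_map_iff, hmap]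
  simp only [ae_iff, Measure.smul_apply, smul_eq_mul, mul_eq_zero, ENNReal.ofReal_eq_zero,
    abs_nonpos_iff, inv_eq_zero, hr, false_or]

lemma measurable_coe_affine (p r : ℝ) :
    Measurable fun t : ℝ => ((p + r * t : ℝ) : UnitAddCircle) :=
  AddCircle.measurable_mk'.comp ((measurable_id.const_mul r).const_add p)

lemma map_affine_restrict_Ioc_le {r : ℝ} (hr : 0 < r) (p u : ℝ) {l : ℝ} (hl : r * l ≤ 1) :
    Measure.map (fun t : ℝ => ((p + r * t : ℝ) : UnitAddCircle))
        (volume.restrict (Ioc u (u + l))) ≤ ENNReal.ofReal r⁻¹ • haarAddCircle := by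
  have hmeas := measurable_coe_affine p r
  refine Measure.le_iff.2 fun A hA => ?_
  rw [Measure.map_apply hmeas hA, Measure.restrict_apply (hmeas hA), Measure.smul_apply,
    haarAddCircle_eq_volume, add_projection_respects_measure (1 : ℝ) (p + r * u) hA]
  have hsub : (fun t : ℝ => ((p + r * t : ℝ) : UnitAddCircle)) ⁻¹' A ∩ Ioc u (u + l) ⊆
      (fun t => r * t) ⁻¹' ((fun t => p + t) ⁻¹'
        (QuotientAddGroup.mk ⁻¹' A ∩ Ioc (p + r * u) (p + r * u + 1))) := by
    rintro t ⟨htA, hut, htu⟩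
    refine ⟨htA, ?_, ?_⟩ <;> dsimp only
    · linarith [mul_lt_mul_of_pos_left hut hr]
    · linarith [mul_le_mul_of_nonneg_left htu hr.le]
  refine (measure_mono hsub).trans ?_
  rw [Real.volume_preimage_mul_left hr.ne', measure_preimage_add, abs_of_pos (inv_pos.2 hr)]
  rfl

/-- The map `y ↦ p + r y` from the fundamental domain `(0, 1]` to the circle. For `p = j / N` and
`r = 1 / N` it is an inverse branch of multiplication by `N`. -/
noncomputable def branch (p r : ℝ) (y : UnitAddCircle) : UnitAddCircle :=
  ((p + r * circleRep 0 y : ℝ) : UnitAddCircle)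

lemma measurable_branch (p r : ℝ) : Measurable (branch p r) :=
  (measurable_coe_affine p r).comp (measurableEmbedding_circleRep 0).measurable

lemma ae_branch_iff {r : ℝ} (hr : 0 < r) (p : ℝ) {P : UnitAddCircle → Prop} :
    (∀ᵐ y ∂(haarAddCircle : Measure UnitAddCircle), P (branch p r y)) ↔
      ∀ᵐ t : ℝ, t ∈ Ioc p (p + r) → P t := by
  refine (ae_circleRep_iff 0 (P := fun t => P ((p + r * t : ℝ) : UnitAddCircle))).trans ?_
  rw [← ae_comp_affine_iff hr.ne' p (P := fun t => t ∈ Ioc p (p + r) → P t)]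
  have hmem (t : ℝ) : t ∈ Ioc (0 : ℝ) (0 + 1) ↔ p + r * t ∈ Ioc p (p + r) := by
    simp [hr]
  simp only [hmem]

lemma ae_branch_of_ae {r : ℝ} (hr : 0 < r) (p : ℝ) {P : UnitAddCircle → Prop}
    (h : ∀ᵐ x ∂(haarAddCircle : Measure UnitAddCircle), P x) :
    ∀ᵐ y ∂(haarAddCircle : Measure UnitAddCircle), P (branch p r y) :=
  (ae_branch_iff hr p).2 ((ae_circle_iff.1 h).mono fun _ ht _ => ht)

lemma map_branch_le {r : ℝ} (hr : 0 < r) (hr1 : r ≤ 1) (p : ℝ) :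
    Measure.map (branch p r) haarAddCircle ≤ ENNReal.ofReal r⁻¹ • haarAddCircle := by
  rw [show branch p r = (fun t : ℝ => ((p + r * t : ℝ) : UnitAddCircle)) ∘ circleRep 0 from rfl,
    ← Measure.map_map (measurable_coe_affine p r) (measurableEmbedding_circleRep 0).measurable,
    map_circleRep]
  exact map_affine_restrict_Ioc_le hr p 0 (by rwa [mul_one])

lemma memLp_comp_branch {E : Type*} [NormedAddCommGroup E] {q : ℝ≥0∞} {r : ℝ} (hr : 0 < r)
    (hr1 : r ≤ 1) (p : ℝ) {g : UnitAddCircle → E} (hg : MemLp g q haarAddCircle) :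
    MemLp (fun y => g (branch p r y)) q haarAddCircle :=
  (hg.of_measure_le_smul ENNReal.ofReal_ne_top (map_branch_le hr hr1 p)).comp_of_map
    (measurable_branch p r).aemeasurable

lemma exists_compLp_of_map_le_smul {X Y 𝕜 E : Type*} [MeasurableSpace X] [MeasurableSpace Y]
    [NontriviallyNormedField 𝕜] [NormedAddCommGroup E] [NormedSpace 𝕜 E] {q : ℝ≥0∞}
    [Fact (1 ≤ q)] (hq : q ≠ ∞) {μ : Measure X} {ν : Measure Y} {φ : X → Y} (hφ : Measurable φ)
    {C : ℝ≥0∞} (hC : C ≠ ∞) (hle : Measure.map φ μ ≤ C • ν) :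
    ∃ T : Lp E q ν →L[𝕜] Lp E q μ, ∀ g : Lp E q ν, T g =ᵐ[μ] fun x => g (φ x) := by
  have hmem (g : Lp E q ν) : MemLp (fun x => g (φ x)) q μ :=
    ((Lp.memLp g).of_measure_le_smul hC hle).comp_of_map hφ.aemeasurable
  have hac : Measure.map φ μ ≪ ν :=
    (Measure.absolutelyContinuous_of_le hle).trans Measure.smul_absolutelyContinuous
  have hqmp : Measure.QuasiMeasurePreserving φ μ ν := ⟨hφ, hac⟩
  let T : Lp E q ν →ₗ[𝕜] Lp E q μ :=
    { toFun := fun g => (hmem g).toLp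
      map_add' := fun f g => by
        rw [← MemLp.toLp_add]
        exact MemLp.toLp_congr _ _ (hqmp.ae (Lp.coeFn_add f g))
      map_smul' := fun c g => by
        rw [RingHom.id_apply, ← MemLp.toLp_const_smul]
        exact MemLp.toLp_congr _ _ (hqmp.ae (Lp.coeFn_smul c g)) }
  refine ⟨T.mkContinuous (C ^ (1 / q).toReal).toReal fun g => ?_, fun g => (hmem g).coeFn_toLp⟩
  have hC' : C ^ (1 / q).toReal ≠ ∞ := ENNReal.rpow_ne_top_of_nonneg (by positivity) hC
  change ‖(hmem g).toLp‖ ≤ _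
  rw [Lp.norm_toLp, Lp.norm_def, ← ENNReal.toReal_mul]
  refine ENNReal.toReal_mono (ENNReal.mul_ne_top hC' (Lp.memLp g).2.ne) ?_
  calc eLpNorm (fun x => g (φ x)) q μ = eLpNorm g q (Measure.map φ μ) :=
        (eLpNorm_map_measure ((Lp.aestronglyMeasurable g).mono_ac hac) hφ.aemeasurable).symm
    _ ≤ eLpNorm g q (C • ν) := eLpNorm_mono_measure _ hle
    _ = C ^ (1 / q).toReal * eLpNorm g q ν := eLpNorm_smul_measure_of_ne_top hq _ C

/-! ### Fourier coefficients and spectra -/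

lemma fourierCoeff_eq_fourierBasis_repr {g : UnitAddCircle → ℂ} (hg : MemLp g 2 haarAddCircle)
    (n : ℤ) : fourierCoeff g n = fourierBasis.repr hg.toLp n := by
  rw [fourierBasis_repr]
  exact congrFun (fourierCoeff_congr_ae hg.coeFn_toLp.symm) n

lemma ae_eq_of_fourierCoeff_eq {f g : UnitAddCircle → ℂ} (hf : MemLp f 2 haarAddCircle)
    (hg : MemLp g 2 haarAddCircle) (h : ∀ n, fourierCoeff f n = fourierCoeff g n) :
    f =ᵐ[haarAddCircle] g := by
  rw [← MemLp.toLp_eq_toLp_iff hf hg]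
  refine fourierBasis.repr.injective (lp.ext (funext fun n => ?_))
  rw [← fourierCoeff_eq_fourierBasis_repr, ← fourierCoeff_eq_fourierBasis_repr, h]

lemma exists_memLp_fourierCoeff_eq (a : ℤ → ℂ) (ha : Summable fun n => ‖a n‖ ^ 2) :
    ∃ g : UnitAddCircle → ℂ, MemLp g 2 haarAddCircle ∧ ∀ n, fourierCoeff g n = a n := by
  have ha2 : Memℓp a 2 := memℓp_gen (by simpa using ha)
  refine ⟨fourierBasis.repr.symm ⟨a, ha2⟩, Lp.memLp _, fun n => ?_⟩
  rw [← fourierBasis_repr, LinearIsometryEquiv.apply_symm_apply]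

lemma summable_norm_sq_fourierCoeff {g : UnitAddCircle → ℂ} (hg : MemLp g 2 haarAddCircle) :
    Summable fun n => ‖fourierCoeff g n‖ ^ 2 := by
  have hsum := (lp.memℓp (fourierBasis.repr hg.toLp)).summable (by norm_num)
  simp_rw [fourierCoeff_eq_fourierBasis_repr hg]
  simpa using hsum

/-- `g` is square integrable on the circle and its Fourier coefficients vanish outside `Λ`. -/
def HasSpectrumIn (Λ : Set ℤ) (g : UnitAddCircle → ℂ) : Prop :=
  MemLp g 2 haarAddCircle ∧ ∀ n ∉ Λ, fourierCoeff g n = 0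

/-- Every function of `L²(S)` is the restriction of exactly one square integrable function with
spectrum in `Λ`. By the open mapping theorem this says that `{e^{2πint}}_{n ∈ Λ}` is a Riesz basis
of `L²(S)`. -/
def IsRieszSpectrum (Λ : Set ℤ) (S : Set UnitAddCircle) : Prop :=
  (∀ G : UnitAddCircle → ℂ, MemLp G 2 haarAddCircle →
    ∃ g, HasSpectrumIn Λ g ∧ ∀ᵐ x ∂haarAddCircle, x ∈ S → g x = G x) ∧
  ∀ g, HasSpectrumIn Λ g → (∀ᵐ x ∂haarAddCircle, x ∈ S → g x = 0) → g =ᵐ[haarAddCircle] 0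

lemma isRieszSpectrum_univ : IsRieszSpectrum univ univ :=
  ⟨fun G hG => ⟨G, ⟨hG, by simp⟩, by simp⟩, fun _ _ h => h.mono fun x hx => hx (mem_univ x)⟩

lemma isRieszSpectrum_empty : IsRieszSpectrum ∅ ∅ := by
  have hzero (n : ℤ) : fourierCoeff (0 : UnitAddCircle → ℂ) n = 0 := by simp [fourierCoeff]
  exact ⟨fun _ _ => ⟨0, ⟨MemLp.zero, fun n _ => hzero n⟩, by simp⟩,
    fun g hg _ => ae_eq_of_fourierCoeff_eq hg.1 MemLp.zero fun n =>
      (hg.2 n (notMem_empty n)).trans (hzero n).symm⟩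

lemma norm_fourier_apply (n : ℤ) (x : UnitAddCircle) : ‖fourier n x‖ = 1 := by
  rw [fourier_apply, Circle.norm_coe]

lemma fourier_apply_add (n : ℤ) (x y : UnitAddCircle) :
    fourier n (x + y) = fourier n x * fourier n y := by
  simp [fourier_apply, smul_add, toCircle_add]

lemma fourier_mul_fourier_neg (n : ℤ) (x : UnitAddCircle) : fourier n x * fourier (-n) x = 1 := by
  rw [← fourier_add, add_neg_cancel, fourier_zero]

lemma memLp_mul_of_norm_le_one {X : Type*} [MeasurableSpace X] {μ : Measure X} {q : ℝ≥0∞}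
    {a g : X → ℂ} (ha : AEStronglyMeasurable a μ) (ha1 : ∀ x, ‖a x‖ ≤ 1) (hg : MemLp g q μ) :
    MemLp (fun x => a x * g x) q μ := by
  refine hg.of_le (ha.mul hg.1) (Eventually.of_forall fun x => ?_)
  rw [norm_mul]
  exact mul_le_of_le_one_left (norm_nonneg _) (ha1 x)

lemma memLp_fourier_comp_mul {X : Type*} [MeasurableSpace X] {μ : Measure X} {q : ℝ≥0∞}
    {φ : X → UnitAddCircle} (hφ : Measurable φ) (n : ℤ) {g : X → ℂ} (hg : MemLp g q μ) :
    MemLp (fun x => fourier n (φ x) * g x) q μ :=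
  memLp_mul_of_norm_le_one
    ((map_continuous (fourier n)).measurable.comp hφ).aestronglyMeasurable
    (fun _ => (norm_fourier_apply n _).le) hg

/-! ### Splitting the spectrum into residue classes -/

lemma measurePreserving_nsmul_circle {N : ℕ} (hN : 0 < N) :
    MeasurePreserving (fun x : UnitAddCircle => N • x) haarAddCircle haarAddCircle := by
  rw [haarAddCircle_eq_volume]
  obtain rfl | h : N = 1 ∨ 1 < N := by omega
  · simp only [one_smul]
    exact MeasurePreserving.id _
  · exact (ergodic_nsmul h).toMeasurePreserving

lemma memLp_dilation {N : ℕ} (hN : 0 < N) (n : ℤ) {g : UnitAddCircle → ℂ}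
    (hg : MemLp g 2 haarAddCircle) :
    MemLp (fun x : UnitAddCircle => fourier n x * g (N • x)) 2 haarAddCircle :=
  memLp_fourier_comp_mul measurable_id n
    (hg.comp_measurePreserving (measurePreserving_nsmul_circle hN))

lemma fourierCoeff_dilation {N : ℕ} (hN : 0 < N) (n k : ℤ) {g : UnitAddCircle → ℂ}
    (hg : AEStronglyMeasurable g haarAddCircle) :
    fourierCoeff (fun x : UnitAddCircle => fourier n x * g (N • x)) (N * k + n) =
      fourierCoeff g k := by
  have hmp := measurePreserving_nsmul_circle hN
  have hchar (x : UnitAddCircle) :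
      fourier (-(N * k + n)) x * fourier n x = fourier (-k) (N • x) := by
    rw [← fourier_add, fourier_apply, fourier_apply, ← natCast_zsmul x N, smul_smul]
    congr 3
    ring
  have hint : AEStronglyMeasurable (fun y => fourier (-k) y • g y)
      (Measure.map (fun x : UnitAddCircle => N • x) haarAddCircle) := by
    rw [hmp.map_eq]
    exact (map_continuous (fourier (-k))).aestronglyMeasurable.smul hg
  have hchange := integral_map hmp.measurable.aemeasurable hint
  rw [hmp.map_eq] at hchange
  rw [fourierCoeff, fourierCoeff, hchange]
  simp only [smul_eq_mul, ← mul_assoc, hchar]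

lemma integral_eq_zero_of_add_right_eq_mul {G : Type*} [MeasurableSpace G] [AddGroup G]
    [MeasurableAdd G] {μ : Measure G} [μ.IsAddRightInvariant] {F : G → ℂ} {h : G} {c : ℂ}
    (hc : c ≠ 1) (hF : ∀ x, F (x + h) = c * F x) : ∫ x, F x ∂μ = 0 := by
  have htr := integral_add_right_eq_self (μ := μ) F h
  simp_rw [hF, integral_const_mul] at htr
  by_contra h0
  exact hc (mul_right_cancel₀ h0 (by rw [htr, one_mul]))

lemma fourier_one_div_natCast_eq_one_iff {N : ℕ} (hN : 0 < N) (m : ℤ) :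
    fourier m ((1 / N : ℝ) : UnitAddCircle) = (1 : ℂ) ↔ (N : ℤ) ∣ m := by
  have hNc : (N : ℂ) ≠ 0 := by exact_mod_cast hN.ne'
  rw [fourier_coe_apply, Complex.exp_eq_one_iff]
  refine exists_congr fun k => ?_
  have hscale : 2 * Real.pi * Complex.I * m * ((1 / N : ℝ) : ℂ) / ((1 : ℝ) : ℂ) =
      (m / N : ℂ) * (2 * Real.pi * Complex.I) := by push_cast; ring
  rw [hscale, mul_left_inj' Complex.two_pi_I_ne_zero, div_eq_iff hNc, mul_comm]
  exact_mod_cast Iff.rfl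

lemma fourierCoeff_dilation_eq_zero {N : ℕ} (hN : 0 < N) {n m : ℤ} (h : ¬ (N : ℤ) ∣ n - m)
    (g : UnitAddCircle → ℂ) :
    fourierCoeff (fun x : UnitAddCircle => fourier n x * g (N • x)) m = 0 := by
  refine integral_eq_zero_of_add_right_eq_mul (h := ((1 / N : ℝ) : UnitAddCircle))
    (mt (fourier_one_div_natCast_eq_one_iff hN (n - m)).1 h) fun x => ?_
  have hperiod : N • ((1 / N : ℝ) : UnitAddCircle) = 0 := by
    rw [← AddCircle.coe_nsmul, nsmul_eq_mul, mul_one_div_cancel (by positivity)]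
    exact AddCircle.coe_period 1
  simp only [smul_eq_mul, smul_add, hperiod, add_zero, fourier_apply_add, sub_eq_neg_add,
    fourier_add]
  ring

/-- The function `∑ n < N, e^{2πinx} gₙ(Nx)`, whose Fourier coefficients in the residue class of `n`
modulo `N` are those of `gₙ`. -/
noncomputable def dilationSum (N : ℕ) (g : ℕ → UnitAddCircle → ℂ) (x : UnitAddCircle) : ℂ :=
  ∑ n ∈ Finset.range N, fourier (n : ℤ) x * g n (N • x)

lemma memLp_dilationSum {N : ℕ} (hN : 0 < N) {g : ℕ → UnitAddCircle → ℂ}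
    (hg : ∀ n < N, MemLp (g n) 2 haarAddCircle) : MemLp (dilationSum N g) 2 haarAddCircle :=
  memLp_finsetSum _ fun n hn => memLp_dilation hN n (hg n (Finset.mem_range.1 hn))

lemma mul_add_natCast_inj {N n n' : ℕ} (hn : n < N) (hn' : n' < N) {k k' : ℤ} :
    (N * k + n : ℤ) = N * k' + n' ↔ k = k' ∧ n = n' := by
  refine ⟨fun h => ?_, by rintro ⟨rfl, rfl⟩; rfl⟩
  have hN : (0 : ℤ) < N := by omega
  have hk := (Int.ediv_emod_unique hN).2
    ⟨(add_comm _ _ : (n : ℤ) + N * k = N * k + n), by omega, by omega⟩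
  have hk' := (Int.ediv_emod_unique hN).2
    ⟨((add_comm _ _).trans h.symm : (n' : ℤ) + N * k' = N * k + n), by omega, by omega⟩
  exact ⟨hk.1.symm.trans hk'.1, by exact_mod_cast hk.2.symm.trans hk'.2⟩

lemma exists_eq_mul_add_natCast {N : ℕ} (hN : 0 < N) (m : ℤ) :
    ∃ n < N, ∃ k : ℤ, m = N * k + n := by
  have hN' : (0 : ℤ) < N := by exact_mod_cast hN
  have hnonneg := Int.emod_nonneg m hN'.ne'
  have hlt := Int.emod_lt_of_pos m hN'
  refine ⟨(m % N).toNat, by omega, m / N, ?_⟩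
  rw [Int.toNat_of_nonneg hnonneg, Int.mul_ediv_add_emod]

lemma fourierCoeff_dilationSum {N : ℕ} (hN : 0 < N) {g : ℕ → UnitAddCircle → ℂ}
    (hg : ∀ n < N, MemLp (g n) 2 haarAddCircle) {n : ℕ} (hn : n < N) (k : ℤ) :
    fourierCoeff (dilationSum N g) (N * k + n) = fourierCoeff (g n) k := by
  have hsum : fourierCoeff (dilationSum N g) (N * k + n) = ∑ i ∈ Finset.range N,
      fourierCoeff (fun x : UnitAddCircle => fourier (i : ℤ) x * g i (N • x)) (N * k + n) := by
    rw [show dilationSum N g = ∑ i ∈ Finset.range N, fun x : UnitAddCircle =>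
      fourier (i : ℤ) x * g i (N • x) from funext fun x => by simp [dilationSum],
      fourierCoeff.sum (Finset.range N)
        (fun i (x : UnitAddCircle) => fourier (i : ℤ) x * g i (N • x))
        fun i hi => (memLp_dilation hN i (hg i (Finset.mem_range.1 hi))).integrable (by norm_num),
      Finset.sum_apply]
  rw [hsum, Finset.sum_eq_single_of_mem n (Finset.mem_range.2 hn),
    fourierCoeff_dilation hN n k (hg n hn).1]
  refine fun i hi hin => fourierCoeff_dilation_eq_zero hN ?_ _
  rintro ⟨l, hl⟩
  have heq : (N * k + n : ℤ) = N * -l + i := by linarith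
  exact hin ((mul_add_natCast_inj hn (Finset.mem_range.1 hi)).1 heq).2.symm

lemma exists_ae_eq_dilationSum {N : ℕ} (hN : 0 < N) {h : UnitAddCircle → ℂ}
    (hh : MemLp h 2 haarAddCircle) :
    ∃ g : ℕ → UnitAddCircle → ℂ, (∀ n, MemLp (g n) 2 haarAddCircle) ∧
      (∀ n k, fourierCoeff (g n) k = fourierCoeff h (N * k + n)) ∧
      h =ᵐ[haarAddCircle] dilationSum N g := by
  have hN' : (N : ℤ) ≠ 0 := by exact_mod_cast hN.ne'
  have hsum (n : ℕ) : Summable fun k : ℤ => ‖fourierCoeff h (N * k + n)‖ ^ 2 :=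
    (summable_norm_sq_fourierCoeff hh).comp_injective (i := fun k : ℤ => N * k + n)
      fun a b hab => mul_left_cancel₀ hN' (add_right_cancel hab)
  choose g hg hgc using fun n : ℕ => exists_memLp_fourierCoeff_eq _ (hsum n)
  refine ⟨g, hg, hgc, ae_eq_of_fourierCoeff_eq hh (memLp_dilationSum hN fun n _ => hg n)
    fun m => ?_⟩
  obtain ⟨n, hn, k, rfl⟩ := exists_eq_mul_add_natCast hN m
  rw [fourierCoeff_dilationSum hN (fun n _ => hg n) hn, hgc]

/-! ### Fibres of multiplication by `N` -/

/-- The `j`-th point of the fibre of `x ↦ N • x` over `y`, for `j < N`. -/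
noncomputable def fibrePt (N j : ℕ) (y : UnitAddCircle) : UnitAddCircle :=
  branch ((j : ℝ) / N) ((N : ℝ)⁻¹) y

open Classical in
/-- The indices of the points of the fibre over `y` which lie in `S`. -/
noncomputable def fibreIdx (N : ℕ) (S : Set UnitAddCircle) (y : UnitAddCircle) : Finset ℕ :=
  (Finset.range N).filter fun j => fibrePt N j y ∈ S

/-- The node `e^{2πij/N}` attached to the `j`-th point of a fibre: along a fibre, the `n`-th
exponential is proportional to the `n`-th power of the node (`fourier_fibrePt`). -/
noncomputable def fibreNode (N j : ℕ) : ℂ := Complex.exp (2 * Real.pi * Complex.I / N) ^ j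

lemma measurable_fibrePt (N j : ℕ) : Measurable (fibrePt N j) := measurable_branch _ _

lemma mem_fibreIdx {N : ℕ} {S : Set UnitAddCircle} {y : UnitAddCircle} {j : ℕ} :
    j ∈ fibreIdx N S y ↔ j < N ∧ fibrePt N j y ∈ S := by
  simp [fibreIdx]

lemma fibreIdx_subset (N : ℕ) (S : Set UnitAddCircle) (y : UnitAddCircle) :
    fibreIdx N S y ⊆ Finset.range N := fun _ hj => Finset.mem_range.2 (mem_fibreIdx.1 hj).1

lemma card_fibreIdx_le (N : ℕ) (S : Set UnitAddCircle) (y : UnitAddCircle) :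
    (fibreIdx N S y).card ≤ N := by
  simpa using Finset.card_le_card (fibreIdx_subset N S y)

lemma measurableSet_fibreIdx_eq (N : ℕ) {S : Set UnitAddCircle} (hS : MeasurableSet S)
    (J : Finset ℕ) : MeasurableSet {y | fibreIdx N S y = J} := by
  have hmem (j : ℕ) : MeasurableSet {y | j < N ∧ fibrePt N j y ∈ S} :=
    (MeasurableSet.const _).inter (measurable_fibrePt N j hS)
  simp only [Finset.ext_iff, mem_fibreIdx, ofPred_forall]
  exact MeasurableSet.iInter fun j => (hmem j).iff (MeasurableSet.const _)

lemma nsmul_fibrePt {N : ℕ} (hN : 0 < N) (j : ℕ) (y : UnitAddCircle) :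
    N • fibrePt N j y = y := by
  have hN' : (N : ℝ) ≠ 0 := by positivity
  have hj : ((j : ℝ) : UnitAddCircle) = 0 := by
    have := AddCircle.coe_nsmul (p := (1 : ℝ)) (n := j) (x := 1)
    rwa [AddCircle.coe_period, nsmul_zero, nsmul_eq_mul, mul_one] at this
  rw [fibrePt, branch, ← AddCircle.coe_nsmul, nsmul_eq_mul, mul_add, mul_div_cancel₀ _ hN',
    mul_inv_cancel_left₀ hN', AddCircle.coe_add, coe_circleRep, hj, zero_add]

lemma fourier_fibrePt (N j n : ℕ) (y : UnitAddCircle) :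
    fourier (n : ℤ) (fibrePt N j y) = fourier (n : ℤ) (fibrePt N 0 y) * fibreNode N j ^ n := by
  simp only [fibrePt, branch, fibreNode, fourier_coe_apply, ← Complex.exp_nat_mul,
    ← Complex.exp_add]
  congr 1
  push_cast
  ring

lemma injOn_fibreNode {N : ℕ} (hN : 0 < N) (S : Set UnitAddCircle) (y : UnitAddCircle) :
    Set.InjOn (fibreNode N) (fibreIdx N S y) := fun _ hi _ hj =>
  (Complex.isPrimitiveRoot_exp N hN.ne').pow_inj (mem_fibreIdx.1 hi).1 (mem_fibreIdx.1 hj).1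

lemma ae_forall_fibrePt {N : ℕ} (hN : 0 < N) {P : UnitAddCircle → Prop}
    (h : ∀ᵐ x ∂haarAddCircle, P x) : ∀ᵐ y ∂haarAddCircle, ∀ j : ℕ, P (fibrePt N j y) :=
  ae_all_iff.2 fun _ => ae_branch_of_ae (by positivity) _ h

lemma exists_lt_mem_Ioc_div {N : ℕ} (hN : 0 < N) {t : ℝ} (ht : t ∈ Ioc (0 : ℝ) 1) :
    ∃ j < N, t ∈ Ioc ((j : ℝ) / N) ((j : ℝ) / N + (N : ℝ)⁻¹) := by
  have hN' : (0 : ℝ) < N := by positivity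
  have hpos : 0 < ⌈N * t⌉₊ := Nat.ceil_pos.2 (mul_pos hN' ht.1)
  have hle : ⌈N * t⌉₊ ≤ N := Nat.ceil_le.2 (by nlinarith [ht.2])
  refine ⟨⌈N * t⌉₊ - 1, by omega, ?_⟩
  rw [Nat.cast_pred hpos, mem_Ioc, div_lt_iff₀ hN', ← one_div, ← add_div, le_div_iff₀ hN']
  constructor
  · linarith [Nat.ceil_lt_add_one (mul_pos hN' ht.1).le]
  · linarith [Nat.le_ceil (N * t)]

lemma ae_of_ae_fibrePt {N : ℕ} (hN : 0 < N) {P : UnitAddCircle → Prop}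
    (h : ∀ᵐ y ∂haarAddCircle, ∀ j < N, P (fibrePt N j y)) : ∀ᵐ x ∂haarAddCircle, P x := by
  have hcell : ∀ᵐ t : ℝ, ∀ j < N, t ∈ Ioc ((j : ℝ) / N) ((j : ℝ) / N + (N : ℝ)⁻¹) → P t :=
    ae_all_iff.2 fun j => eventually_imp_distrib_left.2 fun hj =>
      (ae_branch_iff (by positivity) ((j : ℝ) / N)).1 (h.mono fun y hy => hy j hj)
  rw [ae_circle_iff_Ioc 0]
  filter_upwards [hcell] with t ht h01
  rw [zero_add] at h01
  obtain ⟨j, hj, hjt⟩ := exists_lt_mem_Ioc_div hN h01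
  exact ht j hj hjt

lemma memLp_sum_finset_apply {X ι : Type*} [MeasurableSpace X] {μ : Measure X} {q : ℝ≥0∞}
    {s : X → Finset ι} {T : Finset ι} (hsT : ∀ x, s x ⊆ T)
    (hs : ∀ J, MeasurableSet {x | s x = J}) (c : Finset ι → ι → ℂ) {r : ι → X → ℂ}
    (hr : ∀ j, MemLp (r j) q μ) : MemLp (fun x => ∑ j ∈ s x, c (s x) j * r j x) q μ := by
  have hsplit : (fun x => ∑ j ∈ s x, c (s x) j * r j x) = fun x => ∑ J ∈ T.powerset,
      {x | s x = J}.indicator (fun x => ∑ j ∈ J, c J j * r j x) x := by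
    funext x
    rw [Finset.sum_eq_single_of_mem (s x) (Finset.mem_powerset.2 (hsT x))
      fun J _ hJ => indicator_of_notMem (fun h => hJ h.symm) _]
    simp
  rw [hsplit]
  exact memLp_finsetSum _ fun J _ =>
    (memLp_finsetSum _ fun j _ => (hr j).const_mul (c J j)).indicator (hs J)

/-! ### Riesz spectra from the fibre counting function -/

/-- The value of `G` at the `j`-th point of the fibre over `y`, less the contribution to
`dilationSum N g` of the terms of index at least `k`. -/
noncomputable def fibreResidual (N : ℕ) (G : UnitAddCircle → ℂ) (g : ℕ → UnitAddCircle → ℂ)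
    (k j : ℕ) (y : UnitAddCircle) : ℂ :=
  G (fibrePt N j y) - ∑ n ∈ Finset.Ico k N, fourier (n : ℤ) (fibrePt N j y) * g n y

lemma fibreResidual_zero {N : ℕ} (hN : 0 < N) (G : UnitAddCircle → ℂ)
    (g : ℕ → UnitAddCircle → ℂ) (j : ℕ) (y : UnitAddCircle) :
    fibreResidual N G g 0 j y = G (fibrePt N j y) - dilationSum N g (fibrePt N j y) := by
  simp only [fibreResidual, dilationSum, nsmul_fibrePt hN, Finset.range_eq_Ico]

lemma fibreResidual_update {N k : ℕ} (hk : k < N) (G : UnitAddCircle → ℂ)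
    (g : ℕ → UnitAddCircle → ℂ) (u : UnitAddCircle → ℂ) (j : ℕ) (y : UnitAddCircle) :
    fibreResidual N G (Function.update g k u) k j y =
      fibreResidual N G g (k + 1) j y - fourier (k : ℤ) (fibrePt N j y) * u y := by
  have htail : ∑ n ∈ Finset.Ico (k + 1) N, fourier (n : ℤ) (fibrePt N j y) *
      Function.update g k u n y =
        ∑ n ∈ Finset.Ico (k + 1) N, fourier (n : ℤ) (fibrePt N j y) * g n y :=
    Finset.sum_congr rfl fun n hn => by
      rw [Function.update_of_ne (Nat.lt_of_succ_le (Finset.mem_Ico.1 hn).1).ne']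
  rw [fibreResidual, fibreResidual, Finset.sum_eq_sum_Ico_succ_bot hk, Function.update_self, htail]
  ring

lemma memLp_fibreResidual {N : ℕ} (hN : 0 < N) {G : UnitAddCircle → ℂ}
    (hG : MemLp G 2 haarAddCircle) {g : ℕ → UnitAddCircle → ℂ} {k : ℕ}
    (hg : ∀ n, k ≤ n → n < N → MemLp (g n) 2 haarAddCircle) (j : ℕ) :
    MemLp (fibreResidual N G g k j) 2 haarAddCircle := by
  have hN1 : (N : ℝ)⁻¹ ≤ 1 := inv_le_one_of_one_le₀ (by exact_mod_cast hN)
  refine (memLp_comp_branch (by positivity) hN1 _ hG).sub (memLp_finsetSum _ fun n hn => ?_)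
  rw [Finset.mem_Ico] at hn
  exact memLp_fourier_comp_mul (measurable_fibrePt N j) n (hg n hn.1 hn.2)

lemma exists_hasSpectrumIn_mul_eq_coeff_interpolate {N k : ℕ} {S : Set UnitAddCircle}
    (hS : MeasurableSet S) {Λ : Set ℤ}
    (h : IsRieszSpectrum Λ {y | k < (fibreIdx N S y).card}) {r : ℕ → UnitAddCircle → ℂ}
    (hr : ∀ j, MemLp (r j) 2 haarAddCircle) :
    ∃ u, HasSpectrumIn Λ u ∧ ∀ᵐ y ∂haarAddCircle, k < (fibreIdx N S y).card →
      fourier (k : ℤ) (fibrePt N 0 y) * u y =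
        (Lagrange.interpolate (fibreIdx N S y) (fibreNode N) fun j => r j y).coeff k := by
  have hcoeff : MemLp (fun y => (Lagrange.interpolate (fibreIdx N S y) (fibreNode N)
      fun j => r j y).coeff k) 2 haarAddCircle := by
    simp only [Lagrange.interpolate_apply, Polynomial.finsetSum_coeff, Polynomial.coeff_C_mul,
      mul_comm (r _ _)]
    exact memLp_sum_finset_apply (fibreIdx_subset N S) (measurableSet_fibreIdx_eq N hS)
      (fun J j => (Lagrange.basis J (fibreNode N) j).coeff k) hr
  obtain ⟨u, hu, hueq⟩ := h.1 _ (memLp_fourier_comp_mul (measurable_fibrePt N 0) (-k) hcoeff)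
  refine ⟨u, hu, hueq.mono fun y hy hky => ?_⟩
  rw [hy hky, ← mul_assoc, fourier_mul_fourier_neg, one_mul]

lemma degree_erase_lt_of_degree_lt_succ {R : Type*} [Semiring R] {p : Polynomial R} {k : ℕ}
    (hp : p.degree < ((k + 1 : ℕ) : WithBot ℕ)) : (p.erase k).degree < k := by
  refine (Polynomial.degree_lt_iff_coeff_zero _ _).2 fun m hm => ?_
  obtain rfl | hlt := hm.eq_or_lt
  · exact Polynomial.erase_same p k
  · rw [Polynomial.erase_ne p hlt.ne']
    exact (Polynomial.degree_lt_iff_coeff_zero p (k + 1)).1 hp m hlt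

/-- Successive elimination of the terms of `dilationSum N g`, beginning with the last one: on the
set where the fibre meets `S` in more than `k` points, the `k`-th one is read off the `k`-th
coefficient of the interpolating polynomial. -/
lemma exists_fibreResidual_eq_eval {N : ℕ} (hN : 0 < N) {S : Set UnitAddCircle}
    (hS : MeasurableSet S) {Λ : ℕ → Set ℤ}
    (h : ∀ n < N, IsRieszSpectrum (Λ n) {y | n < (fibreIdx N S y).card})
    {G : UnitAddCircle → ℂ} (hG : MemLp G 2 haarAddCircle) {k : ℕ} (hk : k ≤ N) :
    ∃ g : ℕ → UnitAddCircle → ℂ, (∀ n, k ≤ n → n < N → HasSpectrumIn (Λ n) (g n)) ∧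
      ∀ᵐ y ∂haarAddCircle, k ≤ (fibreIdx N S y).card → ∃ p : Polynomial ℂ, p.degree < k ∧
        ∀ j ∈ fibreIdx N S y, fibreResidual N G g k j y = p.eval (fibreNode N j) := by
  have hinterp {k : ℕ} {y : UnitAddCircle} (r : ℕ → ℂ) (hy : (fibreIdx N S y).card = k) :
      ∃ p : Polynomial ℂ, p.degree < k ∧
        ∀ j ∈ fibreIdx N S y, r j = p.eval (fibreNode N j) :=
    ⟨_, hy ▸ Lagrange.degree_interpolate_lt r (injOn_fibreNode hN S y), fun j hj =>
      (Lagrange.eval_interpolate_at_node r (injOn_fibreNode hN S y) hj).symm⟩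
  induction hk using Nat.decreasingInduction with
  | self =>
    exact ⟨fun _ _ => 0, fun n hn hn' => absurd hn' hn.not_gt, Eventually.of_forall fun y hy =>
      hinterp _ (le_antisymm (card_fibreIdx_le N S y) hy)⟩
  | of_succ k hk ih =>
    obtain ⟨g, hg, hae⟩ := ih
    obtain ⟨u, hu, hueq⟩ := exists_hasSpectrumIn_mul_eq_coeff_interpolate hS (h k hk)
      (memLp_fibreResidual hN hG fun n hn hn' => (hg n hn hn').1)
    refine ⟨Function.update g k u, fun n hn hn' => ?_, ?_⟩
    · obtain rfl | hlt := hn.eq_or_lt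
      · rwa [Function.update_self]
      · rw [Function.update_of_ne hlt.ne']
        exact hg n hlt hn'
    filter_upwards [hae, hueq] with y hy huy hky
    obtain heq | hlt := hky.eq_or_lt
    · exact hinterp _ heq.symm
    obtain ⟨p, hp, hpeval⟩ := hy hlt
    have hpk : p.coeff k = fourier (k : ℤ) (fibrePt N 0 y) * u y := by
      rw [huy hlt, ← Lagrange.eq_interpolate_of_eval_eq _ (injOn_fibreNode hN S y)
        (hp.trans_le (by exact_mod_cast hlt)) fun j hj => (hpeval j hj).symm]
    refine ⟨p.erase k, degree_erase_lt_of_degree_lt_succ hp, fun j hj => ?_⟩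
    have hsplit := congrArg (Polynomial.eval (fibreNode N j)) (Polynomial.monomial_add_erase p k)
    rw [Polynomial.eval_add, Polynomial.eval_monomial, hpk, ← hpeval j hj] at hsplit
    rw [fibreResidual_update hk, fourier_fibrePt, ← hsplit]
    ring

lemma exists_hasSpectrumIn_combine {N : ℕ} (hN : 0 < N) {S : Set UnitAddCircle}
    (hS : MeasurableSet S) {Λ : ℕ → Set ℤ}
    (h : ∀ n < N, IsRieszSpectrum (Λ n) {y | n < (fibreIdx N S y).card})
    {G : UnitAddCircle → ℂ} (hG : MemLp G 2 haarAddCircle) :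
    ∃ f, HasSpectrumIn {m | ∃ n < N, ∃ k ∈ Λ n, m = N * k + n} f ∧
      ∀ᵐ x ∂haarAddCircle, x ∈ S → f x = G x := by
  obtain ⟨g, hg, hae⟩ := exists_fibreResidual_eq_eval hN hS h hG (Nat.zero_le N)
  have hgm (n : ℕ) (hn : n < N) : MemLp (g n) 2 haarAddCircle := (hg n n.zero_le hn).1
  refine ⟨dilationSum N g, ⟨memLp_dilationSum hN hgm, fun m hm => ?_⟩, ae_of_ae_fibrePt hN ?_⟩
  · obtain ⟨n, hn, k, rfl⟩ := exists_eq_mul_add_natCast hN m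
    rw [fourierCoeff_dilationSum hN hgm hn]
    exact (hg n n.zero_le hn).2 k fun hk => hm ⟨n, hn, k, hk, rfl⟩
  · filter_upwards [hae] with y hy j hj hjS
    obtain ⟨p, hp, hpeval⟩ := hy (Nat.zero_le _)
    obtain rfl : p = 0 := Polynomial.degree_eq_bot.1 (WithBot.lt_coe_bot.1 hp)
    have hres := hpeval j (mem_fibreIdx.2 ⟨hj, hjS⟩)
    rw [fibreResidual_zero hN, Polynomial.eval_zero] at hres
    exact (sub_eq_zero.1 hres).symm

lemma eq_zero_of_forall_fibre_sum_eq_zero {N k : ℕ} (hk : k < N) {S : Set UnitAddCircle}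
    {y : UnitAddCircle} {a : ℕ → ℂ} (hcard : k < (fibreIdx N S y).card)
    (htail : ∀ n, k < n → n < N → a n = 0)
    (hsum : ∀ j ∈ fibreIdx N S y,
      ∑ n ∈ Finset.range N, fourier (n : ℤ) (fibrePt N j y) * a n = 0) : a k = 0 := by
  set p : Polynomial ℂ := ∑ n ∈ Finset.range (k + 1),
    Polynomial.monomial n (fourier (n : ℤ) (fibrePt N 0 y) * a n) with hp
  have hdeg : p.degree < (fibreIdx N S y).card := by
    refine Polynomial.mem_degreeLT.1 (Submodule.sum_mem _ fun n hn => ?_)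
    refine Polynomial.mem_degreeLT.2 ((Polynomial.degree_monomial_le n _).trans_lt ?_)
    exact_mod_cast (Nat.lt_succ_iff.1 (Finset.mem_range.1 hn)).trans_lt hcard
  have heval (j : ℕ) (hj : j ∈ fibreIdx N S y) : p.eval (fibreNode N j) = 0 := by
    rw [hp, Polynomial.eval_finsetSum, ← hsum j hj,
      ← Finset.sum_subset (Finset.range_mono (Nat.succ_le_iff.2 hk)) fun n hn hn' => ?_]
    · refine Finset.sum_congr rfl fun n _ => ?_
      rw [Polynomial.eval_monomial, fourier_fibrePt N j]
      ring
    · rw [Finset.mem_range] at hn hn'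
      rw [htail n (by omega) hn, mul_zero]
  have hzero := Polynomial.eq_zero_of_degree_lt_of_eval_index_eq_zero (fibreIdx N S y)
    (injOn_fibreNode (Nat.zero_lt_of_lt hk) S y) hdeg heval
  simpa [hp, Polynomial.finsetSum_coeff, Polynomial.coeff_monomial] using
    congrArg (Polynomial.coeff · k) hzero

lemma ae_eq_zero_of_ae_fibre_sum_eq_zero {N : ℕ} {S : Set UnitAddCircle} {Λ : ℕ → Set ℤ}
    (h : ∀ n < N, IsRieszSpectrum (Λ n) {y | n < (fibreIdx N S y).card})
    {g : ℕ → UnitAddCircle → ℂ} (hg : ∀ n < N, HasSpectrumIn (Λ n) (g n))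
    (hsum : ∀ᵐ y ∂haarAddCircle, ∀ j ∈ fibreIdx N S y,
      ∑ n ∈ Finset.range N, fourier (n : ℤ) (fibrePt N j y) * g n y = 0) {k : ℕ} (hk : k ≤ N) :
    ∀ᵐ y ∂haarAddCircle, ∀ n, k ≤ n → n < N → g n y = 0 := by
  induction hk using Nat.decreasingInduction with
  | self => exact Eventually.of_forall fun y n hn hn' => absurd hn' hn.not_gt
  | of_succ k hk ih =>
    have hgk : g k =ᵐ[haarAddCircle] 0 := by
      refine (h k hk).2 _ (hg k hk) ?_
      filter_upwards [hsum, ih] with y hy htail hky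
      exact eq_zero_of_forall_fibre_sum_eq_zero (a := fun n => g n y) hk hky htail hy
    filter_upwards [hgk, ih] with y hy htail n hn hn'
    obtain rfl | hlt := hn.eq_or_lt
    exacts [hy, htail n hlt hn']

lemma HasSpectrumIn.ae_eq_zero_of_combine {N : ℕ} (hN : 0 < N) {S : Set UnitAddCircle}
    {Λ : ℕ → Set ℤ} (h : ∀ n < N, IsRieszSpectrum (Λ n) {y | n < (fibreIdx N S y).card})
    {f : UnitAddCircle → ℂ} (hf : HasSpectrumIn {m | ∃ n < N, ∃ k ∈ Λ n, m = N * k + n} f)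
    (hf0 : ∀ᵐ x ∂haarAddCircle, x ∈ S → f x = 0) : f =ᵐ[haarAddCircle] 0 := by
  obtain ⟨g, hg, hgc, hfg⟩ := exists_ae_eq_dilationSum hN hf.1
  have hgs (n : ℕ) (hn : n < N) : HasSpectrumIn (Λ n) (g n) := by
    refine ⟨hg n, fun k hk => ?_⟩
    rw [hgc]
    refine hf.2 _ ?_
    rintro ⟨n', hn', k', hk', heq⟩
    obtain ⟨rfl, rfl⟩ := (mul_add_natCast_inj hn hn').1 heq
    exact hk hk'
  have hsum : ∀ᵐ y ∂haarAddCircle, ∀ j ∈ fibreIdx N S y,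
      ∑ n ∈ Finset.range N, fourier (n : ℤ) (fibrePt N j y) * g n y = 0 := by
    filter_upwards [ae_forall_fibrePt hN hfg, ae_forall_fibrePt hN hf0] with y hy hy0 j hj
    simpa only [dilationSum, nsmul_fibrePt hN] using
      (hy j).symm.trans (hy0 j (mem_fibreIdx.1 hj).2)
  have hall := ae_eq_zero_of_ae_fibre_sum_eq_zero h hgs hsum (Nat.zero_le N)
  filter_upwards [hfg, (measurePreserving_nsmul_circle hN).quasiMeasurePreserving.ae hall]
    with x hx hx0
  rw [hx]
  exact Finset.sum_eq_zero fun n hn => by rw [hx0 n n.zero_le (Finset.mem_range.1 hn), mul_zero]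

theorem IsRieszSpectrum.combine {N : ℕ} (hN : 0 < N) {S : Set UnitAddCircle}
    (hS : MeasurableSet S) {Λ : ℕ → Set ℤ}
    (h : ∀ n < N, IsRieszSpectrum (Λ n) {y | n < (fibreIdx N S y).card}) :
    IsRieszSpectrum {m | ∃ n < N, ∃ k ∈ Λ n, m = N * k + n} S :=
  ⟨fun _ hG => exists_hasSpectrumIn_combine hN hS h hG,
    fun _ hf hf0 => hf.ae_eq_zero_of_combine hN h hf0⟩

/-! ### Integer valued periodic step functions -/

/-- `f` is, up to a constant, a sum of `L` upward and `L` downward unit jumps, all repeated with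
period `1`. -/
def IsFloorSum (L : ℕ) (f : ℝ → ℤ) : Prop :=
  ∃ (c : ℤ) (a b : ℕ → ℝ), ∀ t, f t = c + ∑ i ∈ Finset.range L, (⌊t - a i⌋ - ⌊t - b i⌋)

lemma IsFloorSum.succ {L : ℕ} {f : ℝ → ℤ} (h : IsFloorSum L f) : IsFloorSum (L + 1) f := by
  obtain ⟨c, a, b, h⟩ := h
  refine ⟨c, Function.update a L 0, Function.update b L 0, fun t => ?_⟩
  rw [Finset.sum_range_succ, h, Function.update_self, Function.update_self, sub_self, add_zero]
  congr 1
  refine Finset.sum_congr rfl fun i hi => ?_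
  rw [Function.update_of_ne (Finset.mem_range.1 hi).ne,
    Function.update_of_ne (Finset.mem_range.1 hi).ne]

lemma IsFloorSum.add_const {L : ℕ} {f : ℝ → ℤ} (h : IsFloorSum L f) (k : ℤ) :
    IsFloorSum L fun t => f t + k := by
  obtain ⟨c, a, b, h⟩ := h
  exact ⟨c + k, a, b, fun t => by dsimp only; rw [h]; ring⟩

lemma IsFloorSum.add {L L' : ℕ} {f g : ℝ → ℤ} (hf : IsFloorSum L f) (hg : IsFloorSum L' g) :
    IsFloorSum (L + L') fun t => f t + g t := by
  obtain ⟨c, a, b, h⟩ := hf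
  obtain ⟨c', a', b', h'⟩ := hg
  refine ⟨c + c', fun i => if i < L then a i else a' (i - L),
    fun i => if i < L then b i else b' (i - L), fun t => ?_⟩
  have hleft : ∀ i ∈ Finset.range L, (⌊t - if i < L then a i else a' (i - L)⌋ -
      ⌊t - if i < L then b i else b' (i - L)⌋) = ⌊t - a i⌋ - ⌊t - b i⌋ := fun i hi => by
    rw [if_pos (Finset.mem_range.1 hi), if_pos (Finset.mem_range.1 hi)]
  dsimp only
  rw [Finset.sum_range_add, Finset.sum_congr rfl hleft, h, h']
  simp only [add_lt_iff_neg_left, not_lt_zero, if_false, add_tsub_cancel_left]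
  ring

lemma exists_sum_sub_ediv_eq_add {M : ℕ} (hM : 0 < M) :
    ∃ c : ℤ, ∀ A : ℤ, ∑ i ∈ Finset.range M, (A - i) / (M : ℤ) = A + c := by
  have hM' : (M : ℤ) ≠ 0 := by exact_mod_cast hM.ne'
  have hper : Function.Periodic
      (fun A : ℤ => ∑ i ∈ Finset.range M, (A - i) / (M : ℤ) - A) 1 := fun A => by
    have hfirst := Finset.sum_range_succ' (fun i : ℕ => (A + 1 - i) / (M : ℤ)) M
    have hwrap : (A + 1 - (0 : ℕ)) / (M : ℤ) = (A + 1 - M) / (M : ℤ) + 1 := by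
      rw [show A + 1 - ((0 : ℕ) : ℤ) = (A + 1 - M) + 1 * M by push_cast; ring,
        Int.add_mul_ediv_right _ _ hM']
    have hshift (i : ℕ) : A + 1 - ((i + 1 : ℕ) : ℤ) = A - i := by push_cast; ring
    rw [Finset.sum_range_succ] at hfirst
    simp only [hshift] at hfirst
    dsimp only
    linarith
  refine ⟨∑ i ∈ Finset.range M, -(i : ℤ) / (M : ℤ), fun A => ?_⟩
  have hA := hper.int_mul_eq A
  simp only [mul_one, Int.cast_id, zero_sub, sub_zero] at hA
  linarith

lemma exists_sum_floor_fibre_eq_add {N : ℕ} (hN : 0 < N) :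
    ∃ c : ℤ, ∀ t a : ℝ, ∑ j ∈ Finset.range N, ⌊(t + j) / N - a⌋ = ⌊t - N * a⌋ + c := by
  obtain ⟨c, hc⟩ := exists_sum_sub_ediv_eq_add hN
  refine ⟨N - 1 + c, fun t a => ?_⟩
  have hfloor (j : ℕ) : ⌊(t + j) / N - a⌋ = (⌊t - N * a⌋ + j) / (N : ℤ) := by
    rw [show (t + j) / N - a = ((t - N * a) + (j : ℤ)) / N by field_simp; push_cast; ring,
      Int.floor_div_natCast, Int.floor_add_intCast]
  simp_rw [hfloor]
  rw [← Finset.sum_range_reflect, ← add_assoc, ← hc]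
  refine Finset.sum_congr rfl fun j hj => ?_
  congr 1
  have := Finset.mem_range.1 hj
  omega

lemma sum_fibre_floorSum {N : ℕ} (hN : 0 < N) {L : ℕ} {f : ℝ → ℤ} {c : ℤ} {a b : ℕ → ℝ}
    (h : ∀ t, f t = c + ∑ i ∈ Finset.range L, (⌊t - a i⌋ - ⌊t - b i⌋)) (t : ℝ) :
    ∑ j ∈ Finset.range N, f ((t + j) / N) =
      N * c + ∑ i ∈ Finset.range L, (⌊t - N * a i⌋ - ⌊t - N * b i⌋) := by
  obtain ⟨d, hd⟩ := exists_sum_floor_fibre_eq_add hN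
  simp_rw [h]
  rw [Finset.sum_add_distrib, Finset.sum_comm]
  simp [Finset.sum_sub_distrib, hd]

/-- `x` enumerates the jumps of the nondecreasing function `α`, which has `M` jumps per period. -/
def IsJumpSeq (M : ℕ) (x : ℤ → ℝ) (α : ℝ → ℤ) : Prop :=
  (∀ (t : ℝ) (n : ℤ), α (t + n) = α t + n * M) ∧ ∀ j t, x j ≤ t ↔ j ≤ α t

lemma exists_isJumpSeq_of_monotone {M : ℕ} (hM : 0 < M) {α : ℝ → ℤ} (hmono : Monotone α)
    (husc : UpperSemicontinuous α) (hper : ∀ (t : ℝ) (n : ℤ), α (t + n) = α t + n * M) :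
    ∃ x, IsJumpSeq M x α := by
  have hM' : (1 : ℤ) ≤ M := by exact_mod_cast hM
  have hne (j : ℤ) : {t | j ≤ α t}.Nonempty := by
    refine ⟨0 + (|j - α 0| : ℤ), ?_⟩
    rw [mem_ofPred_eq, hper]
    nlinarith [hM', le_abs_self (j - α 0), abs_nonneg (j - α 0)]
  have hbdd (j : ℤ) : BddBelow {t | j ≤ α t} := by
    refine ⟨0 + ((-(|α 0 - j| + 1) : ℤ) : ℝ), fun t ht => ?_⟩
    by_contra hlt
    have hjt : j ≤ α t := ht
    have hle := hjt.trans (hmono (not_le.1 hlt).le)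
    rw [hper] at hle
    nlinarith [hM', le_abs_self (α 0 - j), abs_nonneg (α 0 - j)]
  have hmem (j : ℤ) : j ≤ α (sInf {t | j ≤ α t}) :=
    (husc.isClosed_preimage j).csInf_mem (hne j) (hbdd j)
  exact ⟨fun j => sInf {t | j ≤ α t}, hper, fun j t =>
    ⟨fun h => (hmem j).trans (hmono h), fun h => csInf_le (hbdd j) h⟩⟩

lemma upperSemicontinuous_floor_sub (a : ℝ) : UpperSemicontinuous fun t : ℝ => ⌊t - a⌋ := by
  refine upperSemicontinuous_iff_isClosed_preimage.2 fun j => ?_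
  simp only [preimage, mem_Ici, Int.le_floor]
  exact isClosed_le continuous_const (continuous_sub_right a)

lemma exists_isJumpSeq_sum_floor {M : ℕ} (hM : 0 < M) (a : ℕ → ℝ) :
    ∃ x, IsJumpSeq M x fun t => ∑ i ∈ Finset.range M, ⌊t - a i⌋ := by
  refine exists_isJumpSeq_of_monotone hM (fun s t hst => ?_)
    (upperSemicontinuous_sum fun i _ => upperSemicontinuous_floor_sub (a i)) fun t n => ?_
  · exact Finset.sum_le_sum fun i _ => Int.floor_le_floor (sub_le_sub_right hst _)
  · simp [add_sub_right_comm, Finset.sum_add_distrib, mul_comm]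

lemma IsJumpSeq.apply_add_mul {M : ℕ} {x : ℤ → ℝ} {α : ℝ → ℤ} (h : IsJumpSeq M x α) (j q : ℤ) :
    x (j + q * M) = x j + q := by
  refine eq_of_forall_ge_iff fun t => ?_
  have hper := h.1 (t - q) q
  rw [sub_add_cancel] at hper
  rw [h.2, hper, add_le_add_iff_right, ← h.2, le_sub_iff_add_le]

lemma IsJumpSeq.monotone {M : ℕ} {x : ℤ → ℝ} {α : ℝ → ℤ} (h : IsJumpSeq M x α) : Monotone x :=
  fun i j hij => (h.2 i _).2 (hij.trans ((h.2 j _).1 le_rfl))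

lemma IsJumpSeq.exists_eq_add_sum_floor {M : ℕ} (hM : 0 < M) {x : ℤ → ℝ} {α : ℝ → ℤ}
    (h : IsJumpSeq M x α) (p : ℤ) :
    ∃ c : ℤ, ∀ t, α t = c + ∑ i ∈ Finset.range M, ⌊t - x (p + i)⌋ := by
  have hM' : (0 : ℤ) < M := by exact_mod_cast hM
  have hfloor (j : ℤ) (t : ℝ) : ⌊t - x j⌋ = (α t - j) / (M : ℤ) := by
    refine eq_of_forall_le_iff fun q => ?_
    rw [Int.le_floor, Int.le_ediv_iff_mul_le hM', le_sub_iff_add_le', ← h.apply_add_mul, h.2,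
      le_sub_iff_add_le']
  obtain ⟨c, hc⟩ := exists_sum_sub_ediv_eq_add hM
  refine ⟨p - c, fun t => ?_⟩
  simp_rw [hfloor, ← sub_sub, hc]
  ring

lemma IsJumpSeq.add_const {M : ℕ} {x : ℤ → ℝ} {α : ℝ → ℤ} (h : IsJumpSeq M x α) (m : ℤ) :
    IsJumpSeq M (fun j => x (j - m)) fun t => α t + m :=
  ⟨fun t n => by dsimp only; rw [h.1]; ring, fun j t => by dsimp only; rw [h.2, sub_le_iff_le_add]⟩

lemma IsJumpSeq.max_min {M : ℕ} {x y : ℤ → ℝ} {α β : ℝ → ℤ} (hx : IsJumpSeq M x α)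
    (hy : IsJumpSeq M y β) : IsJumpSeq M (fun j => max (x j) (y j)) fun t => min (α t) (β t) :=
  ⟨fun t n => by dsimp only; rw [hx.1, hy.1, min_add_add_right],
    fun j t => by dsimp only; rw [max_le_iff, hx.2, hy.2, le_min_iff]⟩

lemma IsFloorSum.exists_isJumpSeq {L : ℕ} (hL : 0 < L) {f : ℝ → ℤ} (hf : IsFloorSum L f) :
    ∃ x y α β, IsJumpSeq L x α ∧ IsJumpSeq L y β ∧ ∀ t, f t = α t - β t := by
  obtain ⟨c, a, b, hf⟩ := hf
  obtain ⟨x, hx⟩ := exists_isJumpSeq_sum_floor hL a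
  obtain ⟨y, hy⟩ := exists_isJumpSeq_sum_floor hL b
  refine ⟨_, _, _, _, hx.add_const c, hy, fun t => ?_⟩
  rw [hf, Finset.sum_sub_distrib]
  ring

lemma isFloorSum_sub_of_common_jump {L : ℕ} {u w : ℤ → ℝ} {α β : ℝ → ℤ}
    (hu : IsJumpSeq (L + 1) u α) (hw : IsJumpSeq (L + 1) w β) {p q : ℤ} (hpq : u p = w q) :
    IsFloorSum L fun t => α t - β t := by
  obtain ⟨c, hc⟩ := hu.exists_eq_add_sum_floor (M := L + 1) L.succ_pos p
  obtain ⟨d, hd⟩ := hw.exists_eq_add_sum_floor (M := L + 1) L.succ_pos q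
  refine ⟨c - d, fun i => u (p + (i + 1 : ℕ)), fun i => w (q + (i + 1 : ℕ)), fun t => ?_⟩
  dsimp only
  rw [hc, hd, Finset.sum_range_succ', Finset.sum_range_succ', Finset.sum_sub_distrib]
  simp only [Nat.cast_zero, add_zero, hpq]
  ring

/-- The indicator function of `{β ≤ α}` is `min α β - min α (β - 1)`; if these two functions have
no common jump, then the jumps of `α` and `β` interlace. -/
lemma IsJumpSeq.isFloorSum_le_or {L : ℕ} {x y : ℤ → ℝ} {α β : ℝ → ℤ}
    (hx : IsJumpSeq (L + 1) x α) (hy : IsJumpSeq (L + 1) y β) :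
    IsFloorSum L (fun t => if β t ≤ α t then 1 else 0) ∨ ∀ t, α t = β t ∨ α t = β t - 1 := by
  have hu := hx.max_min hy
  have hw := hx.max_min (hy.add_const (-1))
  have hind : (fun t => if β t ≤ α t then (1 : ℤ) else 0) =
      fun t => min (α t) (β t) - min (α t) (β t + -1) := by
    ext t
    split_ifs <;> omega
  rw [hind]
  refine or_iff_not_imp_left.2 fun hno => ?_
  have hxy (j : ℤ) : x j < y (j + 1) := by
    refine lt_of_not_ge fun hle => hno (isFloorSum_sub_of_common_jump hu hw (p := j) (q := j) ?_)
    have hle' := (hy.monotone (Int.le_add_one le_rfl : j ≤ j + 1)).trans hle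
    simp only [sub_neg_eq_add, max_eq_left hle, max_eq_left hle']
  have hyx (j : ℤ) : y j < x j := by
    refine lt_of_not_ge fun hle =>
      hno (isFloorSum_sub_of_common_jump hu hw (p := j) (q := j - 1) ?_)
    have hle' := (hx.monotone (Int.sub_le_self j zero_le_one)).trans hle
    simp only [sub_neg_eq_add, sub_add_cancel, max_eq_right hle, max_eq_right hle']
  intro t
  have hle : α t ≤ β t := (hy.2 _ t).1 ((hyx _).le.trans ((hx.2 _ t).2 le_rfl))
  have hge : β t - 1 ≤ α t := by
    refine (hx.2 _ t).1 ((hxy _).le.trans ?_)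
    rw [sub_add_cancel]
    exact (hy.2 _ t).2 le_rfl
  omega

lemma IsFloorSum.superlevel_or {L : ℕ} {f : ℝ → ℤ} (hf : IsFloorSum (L + 1) f) (n : ℤ) :
    IsFloorSum L (fun t => if n ≤ f t then 1 else 0) ∨ ∀ t, f t = n ∨ f t = n - 1 := by
  obtain ⟨x, y, α, β, hx, hy, hαβ⟩ := hf.exists_isJumpSeq L.succ_pos
  have hiff (t : ℝ) : n ≤ f t ↔ β t + n ≤ α t := by rw [hαβ]; omega
  simp only [hiff]
  refine (hx.isFloorSum_le_or (hy.add_const n)).imp_right fun h t => ?_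
  rcases h t with h | h <;> [left; right] <;> rw [hαβ] <;> omega

lemma IsFloorSum.superlevel {L : ℕ} {f : ℝ → ℤ} (hf : IsFloorSum L f) (n : ℤ) :
    IsFloorSum L (fun t => if n ≤ f t then 1 else 0) := by
  rcases L with _ | L
  · obtain ⟨c, a, b, hf⟩ := hf
    exact ⟨if n ≤ c then 1 else 0, a, b, fun t => by simp [hf]⟩
  · obtain h | h := hf.superlevel_or n
    · exact h.succ
    · convert hf.add_const (1 - n) using 2 with t
      rcases h t with h | h <;> rw [h] <;> split_ifs <;> omega

/-! ### Mean squares of exponential sums -/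

lemma fourierChar_eq_one_iff {x : ℝ} : 𝐞 x = 1 ↔ ∃ k : ℤ, x = k := by
  rw [Real.fourierChar_apply', Circle.exp_eq_one]
  refine exists_congr fun k => ?_
  rw [mul_comm, mul_left_inj' Real.two_pi_pos.ne']

lemma fourierChar_intCast (k : ℤ) : 𝐞 k = 1 := fourierChar_eq_one_iff.2 ⟨k, rfl⟩

lemma fourierChar_natCast_mul (n : ℕ) (x : ℝ) : 𝐞 (n * x) = 𝐞 x ^ n := by
  rw [← nsmul_eq_mul, AddChar.map_nsmul_eq_pow]

lemma coe_fourierChar_neg (x : ℝ) : (𝐞 (-x) : ℂ) = starRingEnd ℂ (𝐞 x) := by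
  rw [AddChar.map_neg_eq_inv, Circle.coe_inv_eq_conj]

lemma coe_fourierChar_add (x y : ℝ) : (𝐞 (x + y) : ℂ) = 𝐞 x * 𝐞 y := by
  rw [AddChar.map_add_eq_mul, Circle.coe_mul]

open Classical in
lemma tendsto_average_fourierChar (x : ℝ) :
    Tendsto (fun K : ℕ => (K : ℂ)⁻¹ * ∑ n ∈ Finset.range K, (𝐞 (n * x) : ℂ)) atTop
      (nhds (if ∃ k : ℤ, x = k then 1 else 0)) := by
  simp_rw [fourierChar_natCast_mul, Circle.coe_pow]
  split_ifs with h
  · rw [fourierChar_eq_one_iff.2 h]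
    refine tendsto_const_nhds.congr' ?_
    filter_upwards [eventually_gt_atTop 0] with K hK
    have : (K : ℂ) ≠ 0 := by exact_mod_cast hK.ne'
    simp [this]
  · have hne : (𝐞 x : ℂ) ≠ 1 := fun h' => h (fourierChar_eq_one_iff.1 (Circle.coe_eq_one.1 h'))
    refine squeeze_zero_norm (a := fun K : ℕ => (2 / ‖(𝐞 x : ℂ) - 1‖) * (K : ℝ)⁻¹) (fun K => ?_) ?_
    · rw [norm_mul, norm_inv, Complex.norm_natCast, geom_sum_eq hne, norm_div, mul_comm]
      gcongr
      refine (norm_sub_le _ _).trans ?_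
      rw [norm_pow, Circle.norm_coe]
      norm_num
    · simpa using tendsto_inv_atTop_nhds_zero_nat.const_mul (2 / ‖(𝐞 x : ℂ) - 1‖)

lemma norm_sq_sum_fourierChar {ι : Type*} [Fintype ι] (ε x : ι → ℝ) :
    ‖∑ p, (ε p : ℂ) * 𝐞 (x p)‖ ^ 2 = ∑ p, ∑ q, ε p * ε q * (𝐞 (x p - x q) : ℂ).re := by
  have hterm (p q : ι) : (ε p : ℂ) * 𝐞 (x p) * starRingEnd ℂ (ε q * 𝐞 (x q)) =
      ((ε p * ε q : ℝ) : ℂ) * 𝐞 (x p - x q) := by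
    rw [sub_eq_add_neg, coe_fourierChar_add, coe_fourierChar_neg, map_mul, Complex.conj_ofReal]
    push_cast
    ring
  have hsq := Complex.mul_conj' (∑ p, (ε p : ℂ) * 𝐞 (x p))
  rw [map_sum, Finset.sum_mul_sum] at hsq
  simpa only [hterm, Complex.re_sum, Complex.re_ofReal_mul, ← Complex.ofReal_pow,
    Complex.ofReal_re] using (congrArg Complex.re hsq).symm

open Classical in
lemma tendsto_average_norm_sq {ι : Type*} [Fintype ι] (ε x : ι → ℝ) :
    Tendsto (fun K : ℕ => (K : ℝ)⁻¹ *
        ∑ n ∈ Finset.range K, ‖∑ p, (ε p : ℂ) * 𝐞 (n * x p)‖ ^ 2) atTop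
      (nhds (∑ p, ∑ q, ε p * ε q * if ∃ k : ℤ, x p - x q = k then 1 else 0)) := by
  have hre (y : ℝ) : Tendsto (fun K : ℕ => (K : ℝ)⁻¹ *
      ∑ n ∈ Finset.range K, (𝐞 (n * y) : ℂ).re) atTop
      (nhds (if ∃ k : ℤ, y = k then 1 else 0)) := by
    convert (Complex.continuous_re.tendsto _).comp (tendsto_average_fourierChar y) using 2 with K
    · rw [Function.comp_apply, ← Complex.ofReal_natCast, ← Complex.ofReal_inv,
        Complex.re_ofReal_mul, Complex.re_sum]
    · split_ifs <;> simp
  refine (tendsto_finsetSum _ fun p _ => tendsto_finsetSum _ fun q _ =>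
    (hre (x p - x q)).const_mul (ε p * ε q)).congr fun K => ?_
  simp_rw [norm_sq_sum_fourierChar, ← mul_sub]
  rw [Finset.sum_comm (s := Finset.range K), Finset.mul_sum]
  refine Finset.sum_congr rfl fun p _ => ?_
  rw [Finset.sum_comm (s := Finset.range K), Finset.mul_sum]
  refine Finset.sum_congr rfl fun q _ => ?_
  rw [← Finset.mul_sum, mul_left_comm]

open Classical in
lemma sum_sq_le_sum_sum_mul_ite {ι : Type*} [Fintype ι] (ε x : ι → ℝ)
    (h : ∀ p q, ∀ k : ℤ, x p - x q = k → 0 ≤ ε p * ε q) :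
    ∑ p, ε p ^ 2 ≤ ∑ p, ∑ q, ε p * ε q * if ∃ k : ℤ, x p - x q = k then 1 else 0 := by
  refine Finset.sum_le_sum fun p _ => ?_
  have hdiag : ε p ^ 2 = ε p * ε p * if ∃ k : ℤ, x p - x p = k then 1 else 0 := by
    rw [if_pos ⟨0, by simp⟩, mul_one, sq]
  rw [hdiag]
  refine Finset.single_le_sum
    (f := fun q => ε p * ε q * if ∃ k : ℤ, x p - x q = k then (1 : ℝ) else 0)
    (fun q _ => ?_) (Finset.mem_univ p)
  split_ifs with hk
  · obtain ⟨k, hk⟩ := hk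
    simpa using h p q k hk
  · simp

/-- The Fourier transform of the signed measure `∑ i < L, (δ_{a i} - δ_{b i})`, up to the sign of
the frequency: the jumps of the step function `t ↦ ∑ i < L, (⌊t - a i⌋ - ⌊t - b i⌋)`. -/
noncomputable def jumpTransform (L : ℕ) (a b : ℕ → ℝ) (r : ℝ) : ℂ :=
  ∑ i ∈ Finset.range L, ((𝐞 (r * a i) : ℂ) - 𝐞 (r * b i))

lemma jumpTransform_mul (L : ℕ) (a b : ℕ → ℝ) (r s : ℝ) :
    jumpTransform L (fun i => s * a i) (fun i => s * b i) r = jumpTransform L a b (r * s) := by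
  simp only [jumpTransform, mul_assoc]

lemma jumpTransform_zero (L : ℕ) (a b : ℕ → ℝ) : jumpTransform L a b 0 = 0 := by
  simp [jumpTransform]

lemma norm_jumpTransform_neg (L : ℕ) (a b : ℕ → ℝ) (r : ℝ) :
    ‖jumpTransform L a b (-r)‖ = ‖jumpTransform L a b r‖ := by
  simp only [jumpTransform, neg_mul, coe_fourierChar_neg, ← map_sub, ← map_sum, Complex.norm_conj]

lemma exists_tendsto_average_norm_sq_jumpTransform {L : ℕ} {a b : ℕ → ℝ}
    (hab : ∀ i < L, ∀ j < L, ∀ k : ℤ, a i - b j ≠ k) :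
    ∃ A : ℝ, 2 * L ≤ A ∧ Tendsto (fun K : ℕ => (K : ℝ)⁻¹ *
      ∑ n ∈ Finset.range K, ‖jumpTransform L a b n‖ ^ 2) atTop (nhds A) := by
  classical
  let ε : Fin L ⊕ Fin L → ℝ := Sum.elim 1 (-1)
  let x : Fin L ⊕ Fin L → ℝ := Sum.elim (fun i => a i) (fun i => b i)
  have hsum (n : ℕ) : ∑ p, (ε p : ℂ) * 𝐞 (n * x p) = jumpTransform L a b n := by
    simp [jumpTransform, ε, x, Finset.sum_range, ← sub_eq_add_neg]
  have hlim := tendsto_average_norm_sq ε x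
  simp only [hsum] at hlim
  refine ⟨_, ?_, hlim⟩
  refine le_trans (le_of_eq ?_) (sum_sq_le_sum_sum_mul_ite ε x ?_)
  · simp [ε, two_mul]
  · rintro (p | p) (q | q) k hk
    · simp [ε]
    · exact absurd hk (hab p p.2 q q.2 k)
    · refine absurd ?_ (hab q q.2 p p.2 (-k))
      rw [Int.cast_neg, ← hk, neg_sub]
      rfl
    · simp [ε]

lemma exists_lt_norm_sq_jumpTransform {L : ℕ} (hL : 2 ≤ L) {a b : ℕ → ℝ}
    (hab : ∀ i < L, ∀ j < L, ∀ k : ℤ, 2 * (a i - b j) ≠ k) :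
    ∃ N : ℕ, 0 < N ∧ Real.pi ^ 2 / 2 <
      ‖jumpTransform L a b N‖ ^ 2 + ‖jumpTransform L a b (N * 2)‖ ^ 2 / 4 := by
  by_contra! hN
  obtain ⟨A, hA, hAlim⟩ := exists_tendsto_average_norm_sq_jumpTransform fun i hi j hj k hk =>
    hab i hi j hj (2 * k) (by rw [hk]; push_cast; ring)
  obtain ⟨B, hB, hBlim⟩ := exists_tendsto_average_norm_sq_jumpTransform
    (a := fun i => 2 * a i) (b := fun i => 2 * b i) fun i hi j hj k hk =>
      hab i hi j hj k (by rw [← hk]; ring)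
  simp only [jumpTransform_mul] at hBlim
  have hbound (n : ℕ) : ‖jumpTransform L a b n‖ ^ 2 + ‖jumpTransform L a b (n * 2)‖ ^ 2 / 4 ≤
      Real.pi ^ 2 / 2 := by
    rcases Nat.eq_zero_or_pos n with rfl | hn
    · rw [Nat.cast_zero, zero_mul, jumpTransform_zero, norm_zero, sq, mul_zero, zero_div, add_zero]
      positivity
    · exact hN n hn
  have haverage (K : ℕ) : (K : ℝ)⁻¹ * ∑ n ∈ Finset.range K, ‖jumpTransform L a b n‖ ^ 2 +
      ((K : ℝ)⁻¹ * ∑ n ∈ Finset.range K, ‖jumpTransform L a b (n * 2)‖ ^ 2) / 4 ≤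
      Real.pi ^ 2 / 2 := by
    rw [mul_div_assoc, ← mul_add, Finset.sum_div, ← Finset.sum_add_distrib]
    refine inv_mul_le_of_le_mul₀ K.cast_nonneg (by positivity) ?_
    simpa using Finset.sum_le_card_nsmul (Finset.range K) _ _ fun n _ => hbound n
  have hle := le_of_tendsto' (hAlim.add (hBlim.div_const 4)) haverage
  have hL' : (2 : ℝ) ≤ L := by exact_mod_cast hL
  nlinarith [Real.pi_lt_d2, Real.pi_pos]

/-! ### Fourier coefficients of step functions -/

lemma fourierCoeffOn_zero_one (f : ℝ → ℂ) (k : ℤ) :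
    fourierCoeffOn zero_lt_one f k = ∫ t in (0 : ℝ)..1, (𝐞 (-(k * t)) : ℂ) * f t := by
  rw [fourierCoeffOn_eq_integral]
  simp only [sub_zero, div_one, one_smul]
  refine intervalIntegral.integral_congr fun t _ => ?_
  rw [fourier_coe_apply, smul_eq_mul, Real.fourierChar_apply]
  push_cast
  ring_nf

lemma integral_fourierChar {k : ℤ} (hk : k ≠ 0) :
    ∫ t in (0 : ℝ)..1, (𝐞 (-(k * t)) : ℂ) = 0 := by
  have h := bernoulliFourierCoeff_recurrence 0 hk
  rw [bernoulliFourierCoeff, fourierCoeffOn_zero_one] at h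
  simpa using h

lemma integral_fourierChar_mul_fract (k : ℤ) :
    ∫ t in (0 : ℝ)..1, (𝐞 (-(k * t)) : ℂ) * (Int.fract t - 1 / 2 : ℝ) =
      -(2 * Real.pi * Complex.I * k)⁻¹ := by
  have h := bernoulliFourierCoeff_eq one_ne_zero k
  rw [bernoulliFourierCoeff, fourierCoeffOn_zero_one] at h
  have hne : ∀ᵐ t : ℝ, t ≠ 1 := by simp [ae_iff]
  rw [show -(2 * Real.pi * Complex.I * k)⁻¹ = -(1 : ℕ).factorial / (2 * Real.pi * Complex.I * k) ^ 1
    by simp [neg_div], ← h]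
  refine intervalIntegral.integral_congr_ae ?_
  filter_upwards [hne] with t ht1 ht
  rw [uIoc_of_le zero_le_one] at ht
  rw [Int.fract_eq_self.2 ⟨ht.1.le, ht.2.lt_of_ne ht1⟩, bernoulliFun_one]

lemma integral_fourierChar_mul_fract_sub (k : ℤ) (a : ℝ) :
    ∫ t in (0 : ℝ)..1, (𝐞 (-(k * t)) : ℂ) * (Int.fract (t - a) - 1 / 2 : ℝ) =
      -(𝐞 (-k * a) * (2 * Real.pi * Complex.I * k)⁻¹) := by
  have hper : Function.Periodic
      (fun t : ℝ => (𝐞 (-(k * t)) : ℂ) * (Int.fract (t - a) - 1 / 2 : ℝ)) 1 := fun t => by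
    dsimp only
    rw [add_sub_right_comm, Int.fract_add_one, mul_add_one, neg_add, ← Int.cast_neg,
      AddChar.map_add_eq_mul, fourierChar_intCast, mul_one]
  have hshift := hper.intervalIntegral_add_eq 0 (0 + a)
  rw [add_right_comm, ← intervalIntegral.integral_comp_add_right, zero_add] at hshift
  rw [hshift, ← mul_neg, ← integral_fourierChar_mul_fract, ← intervalIntegral.integral_const_mul]
  refine intervalIntegral.integral_congr fun t _ => ?_
  rw [add_sub_cancel_right, mul_add, neg_add, coe_fourierChar_add, neg_mul]
  ring

lemma intervalIntegrable_fourierChar_mul_fract_sub (k : ℤ) (a : ℝ) :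
    IntervalIntegrable (fun t : ℝ => (𝐞 (-(k * t)) : ℂ) * (Int.fract (t - a) - 1 / 2 : ℝ))
      volume 0 1 := by
  have hmeas : Measurable fun t : ℝ => (𝐞 (-(k * t)) : ℂ) * (Int.fract (t - a) - 1 / 2 : ℝ) := by
    fun_prop
  refine (intervalIntegrable_const (c := (1 : ℝ))).mono_fun hmeas.aestronglyMeasurable
    (Eventually.of_forall fun t => ?_)
  have h0 := Int.fract_nonneg (t - a)
  have h1 := Int.fract_lt_one (t - a)
  dsimp only
  rw [norm_mul, Circle.norm_coe, one_mul, Complex.norm_real, norm_one, Real.norm_eq_abs, abs_le]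
  constructor <;> linarith

lemma integral_fourierChar_mul_floorSum {k : ℤ} (hk : k ≠ 0) (L : ℕ) (a b : ℕ → ℝ) (d : ℝ) :
    ∫ t in (0 : ℝ)..1, (𝐞 (-(k * t)) : ℂ) *
        (d + (∑ i ∈ Finset.range L, (⌊t - a i⌋ - ⌊t - b i⌋) : ℤ) : ℝ) =
      jumpTransform L a b (-k) * (2 * Real.pi * Complex.I * k)⁻¹ := by
  have hsplit (t : ℝ) : (𝐞 (-(k * t)) : ℂ) *
      (d + (∑ i ∈ Finset.range L, (⌊t - a i⌋ - ⌊t - b i⌋) : ℤ) : ℝ) =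
      (𝐞 (-(k * t)) : ℂ) * (d + ∑ i ∈ Finset.range L, (b i - a i) : ℝ) +
        ∑ i ∈ Finset.range L, ((𝐞 (-(k * t)) : ℂ) * (Int.fract (t - b i) - 1 / 2 : ℝ) -
          (𝐞 (-(k * t)) : ℂ) * (Int.fract (t - a i) - 1 / 2 : ℝ)) := by
    simp only [← mul_sub, ← Finset.mul_sum, ← mul_add, ← Int.self_sub_floor]
    push_cast
    rw [add_assoc, ← Finset.sum_add_distrib]
    congr 3 with i
    ring
  have hint (i : ℕ) := (intervalIntegrable_fourierChar_mul_fract_sub k (b i)).sub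
    (intervalIntegrable_fourierChar_mul_fract_sub k (a i))
  have hintsum := IntervalIntegrable.sum (Finset.range L) fun i _ => hint i
  rw [Finset.sum_fn] at hintsum
  simp_rw [hsplit]
  rw [intervalIntegral.integral_add (Continuous.intervalIntegrable (by fun_prop) _ _) hintsum,
    intervalIntegral.integral_mul_const, integral_fourierChar hk, zero_mul, zero_add,
    intervalIntegral.integral_finsetSum fun i _ => hint i, jumpTransform, Finset.sum_mul]
  refine Finset.sum_congr rfl fun i _ => ?_
  rw [intervalIntegral.integral_sub (intervalIntegrable_fourierChar_mul_fract_sub k (b i))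
      (intervalIntegrable_fourierChar_mul_fract_sub k (a i)),
    integral_fourierChar_mul_fract_sub, integral_fourierChar_mul_fract_sub]
  ring

lemma measurable_floorSum (L : ℕ) (a b : ℕ → ℝ) :
    Measurable fun t : ℝ => ∑ i ∈ Finset.range L, (⌊t - a i⌋ - ⌊t - b i⌋) := by
  fun_prop

/-- Bessel's inequality for a step function of modulus `1 / 2`, with the frequencies `±1`, `±2`. -/
lemma norm_sq_jumpTransform_add_le {L : ℕ} {c n : ℤ} {a b : ℕ → ℝ}
    (h : ∀ t, c + ∑ i ∈ Finset.range L, (⌊t - a i⌋ - ⌊t - b i⌋) = n ∨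
      c + ∑ i ∈ Finset.range L, (⌊t - a i⌋ - ⌊t - b i⌋) = n - 1) :
    ‖jumpTransform L a b 1‖ ^ 2 + ‖jumpTransform L a b 2‖ ^ 2 / 4 ≤ Real.pi ^ 2 / 2 := by
  let u : ℝ → ℂ := fun t => ((c - n + 1 / 2 : ℝ) +
    (∑ i ∈ Finset.range L, (⌊t - a i⌋ - ⌊t - b i⌋) : ℤ) : ℝ)
  have hnorm (t : ℝ) : ‖u t‖ = 1 / 2 := by
    have hcast : u t =
        (((c + ∑ i ∈ Finset.range L, (⌊t - a i⌋ - ⌊t - b i⌋) : ℤ) - n + 1 / 2 : ℝ) : ℂ) := by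
      simp only [u]
      push_cast
      ring
    rw [hcast, Complex.norm_real, Real.norm_eq_abs]
    rcases h t with h | h <;> rw [h] <;> push_cast <;> ring_nf <;> norm_num
  have hmeas : Measurable u := by
    have := measurable_floorSum L a b
    fun_prop
  have hL2 : MemLp u 2 (volume.restrict (Ioc 0 1)) :=
    MemLp.of_bound hmeas.aestronglyMeasurable (1 / 2) (Eventually.of_forall fun t => (hnorm t).le)
  have hcoeff {k : ℤ} (hk : k ≠ 0) : ‖fourierCoeffOn zero_lt_one u k‖ ^ 2 =
      ‖jumpTransform L a b k‖ ^ 2 / (4 * Real.pi ^ 2 * k ^ 2) := by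
    rw [fourierCoeffOn_zero_one, integral_fourierChar_mul_floorSum hk, norm_mul,
      norm_jumpTransform_neg, norm_inv]
    simp only [norm_mul, Complex.norm_real, Complex.norm_I, Complex.norm_intCast,
      Complex.norm_ofNat, Real.norm_eq_abs, mul_pow, inv_pow, sq_abs, div_eq_mul_inv]
    norm_num
  have hbessel := sum_le_hasSum ({1, -1, 2, -2} : Finset ℤ) (fun i _ => sq_nonneg _)
    (hasSum_sq_fourierCoeffOn (zero_lt_one (α := ℝ)) hL2)
  rw [Finset.sum_insert (by decide), Finset.sum_insert (by decide),
    Finset.sum_insert (by decide), Finset.sum_singleton, hcoeff (by decide),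
    hcoeff (by decide), hcoeff (by decide), hcoeff (by decide)] at hbessel
  simp only [hnorm, Int.cast_neg, norm_jumpTransform_neg, Int.cast_one, Int.cast_ofNat] at hbessel
  norm_num at hbessel
  field_simp at hbessel
  linarith

/-! ### Folding reduces the number of jumps -/

lemma isFloorSum_of_sub_eq_int {L : ℕ} {f : ℝ → ℤ} {c : ℤ} {a b : ℕ → ℝ}
    (h : ∀ t, f t = c + ∑ i ∈ Finset.range (L + 1), (⌊t - a i⌋ - ⌊t - b i⌋)) {i j : ℕ}
    (hi : i < L + 1) (hj : j < L + 1) {k : ℤ} (hk : a i - b j = k) : IsFloorSum L f := by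
  have hswap (F : ℕ → ℤ) {i : ℕ} (hi : i < L + 1) : ∑ l ∈ Finset.range (L + 1), F l =
      ∑ l ∈ Finset.range L, F (Equiv.swap i L l) + F i := by
    rw [← Equiv.Perm.sum_comp (Equiv.swap i L) (Finset.range (L + 1)) F, Finset.sum_range_succ,
      Equiv.swap_apply_right]
    intro l hl
    rw [Finset.coe_range, mem_Iio]
    by_contra hlt
    exact hl (Equiv.swap_apply_of_ne_of_ne (by omega) (by omega))
  refine ⟨c - k, fun l => a (Equiv.swap i L l), fun l => b (Equiv.swap j L l), fun t => ?_⟩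
  rw [h, Finset.sum_sub_distrib, hswap (fun l => ⌊t - a l⌋) hi, hswap (fun l => ⌊t - b l⌋) hj,
    Finset.sum_sub_distrib, show t - a i = t - b j - k by rw [← hk]; ring, Int.floor_sub_intCast]
  ring

/-- If some upward and some downward jump of `f` differ by a multiple of `1 / 2`, they cancel in the
double folding; otherwise the mean value of the jump transforms violates Bessel's inequality, so
some folding has a superlevel set with fewer jumps. -/
lemma IsFloorSum.exists_reducing_fold {L : ℕ} (hL : 1 ≤ L) {f : ℝ → ℤ}
    (hf : IsFloorSum (L + 1) f) :
    ∃ N : ℕ, 0 < N ∧ ∀ n : ℤ,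
      IsFloorSum L fun t => if n ≤ ∑ j ∈ Finset.range N, f ((t + j) / N) then 1 else 0 := by
  obtain ⟨c, a, b, hf⟩ := hf
  by_cases hab : ∃ i < L + 1, ∃ j < L + 1, ∃ k : ℤ, 2 * (a i - b j) = k
  · obtain ⟨i, hi, j, hj, k, hk⟩ := hab
    refine ⟨2, two_pos, IsFloorSum.superlevel
      (isFloorSum_of_sub_eq_int (sum_fibre_floorSum two_pos hf) hi hj (k := k) ?_)⟩
    rw [← hk, Nat.cast_ofNat, mul_sub]
  · push Not at hab
    obtain ⟨N, hN, hlt⟩ := exists_lt_norm_sq_jumpTransform (by omega) hab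
    have hfold := sum_fibre_floorSum hN hf
    have hF : IsFloorSum (L + 1) fun t => ∑ j ∈ Finset.range N, f ((t + j) / N) :=
      ⟨_, _, _, hfold⟩
    refine ⟨N, hN, fun n => (hF.superlevel_or n).resolve_right fun htwo => hlt.not_ge ?_⟩
    have hle := norm_sq_jumpTransform_add_le (c := N * c) (n := n) fun t => by
      rw [← hfold]
      exact htwo t
    rwa [jumpTransform_mul, jumpTransform_mul, one_mul, mul_comm] at hle

/-! ### Spectral subspaces -/

/-- The closed subspace of `L²` of functions whose spectrum is contained in `Λ`. -/
noncomputable def spectralSubspace (Λ : Set ℤ) :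
    Submodule ℂ (Lp ℂ 2 (haarAddCircle : Measure UnitAddCircle)) where
  carrier := {g | ∀ n ∉ Λ, fourierBasis.repr g n = 0}
  zero_mem' := fun n _ => by simp
  add_mem' := fun hf hg n hn => by simp [hf n hn, hg n hn]
  smul_mem' := fun c f hf n hn => by simp [hf n hn]

lemma mem_spectralSubspace {Λ : Set ℤ} {g : Lp ℂ 2 (haarAddCircle : Measure UnitAddCircle)} :
    g ∈ spectralSubspace Λ ↔ ∀ n ∉ Λ, fourierBasis.repr g n = 0 := Iff.rfl

lemma HasSpectrumIn.toLp_mem {Λ : Set ℤ} {g : UnitAddCircle → ℂ} (hg : HasSpectrumIn Λ g) :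
    hg.1.toLp ∈ spectralSubspace Λ := fun n hn => by
  rw [← fourierCoeff_eq_fourierBasis_repr, hg.2 n hn]

lemma hasSpectrumIn_of_mem {Λ : Set ℤ} {g : Lp ℂ 2 (haarAddCircle : Measure UnitAddCircle)}
    (hg : g ∈ spectralSubspace Λ) : HasSpectrumIn Λ g :=
  ⟨Lp.memLp g, fun n hn => by rw [← fourierBasis_repr, hg n hn]⟩

instance completeSpace_spectralSubspace (Λ : Set ℤ) : CompleteSpace (spectralSubspace Λ) := by
  have hcarrier : (spectralSubspace Λ : Set (Lp ℂ 2 (haarAddCircle : Measure UnitAddCircle))) =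
      ⋂ n ∈ Λᶜ, {g | inner ℂ (fourierBasis n) g = 0} := by
    ext g
    simp only [SetLike.mem_coe, mem_spectralSubspace, mem_iInter, mem_compl_iff, mem_ofPred_eq,
      HilbertBasis.repr_apply_apply]
  refine IsClosed.completeSpace_coe (hs := ?_)
  rw [hcarrier]
  exact isClosed_biInter fun n _ =>
    isClosed_eq (continuous_const.inner continuous_id) continuous_const

lemma orthonormal_smul_comp {𝕜 E ι κ : Type*} [RCLike 𝕜] [NormedAddCommGroup E]
    [InnerProductSpace 𝕜 E] {v : κ → E} (hv : Orthonormal 𝕜 v) {e : ι → κ}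
    (he : Function.Injective e) {c : ι → 𝕜} (hc : ∀ i, ‖c i‖ = 1) :
    Orthonormal 𝕜 fun i => c i • v (e i) := by
  refine ⟨fun i => by rw [norm_smul, hc, hv.1, one_mul], fun i j hij => ?_⟩
  change inner 𝕜 (c i • v (e i)) (c j • v (e j)) = 0
  rw [inner_smul_left, inner_smul_right, hv.2 (he.ne hij), mul_zero, mul_zero]

lemma smul_fourierBasis_mem_spectralSubspace {Λ : Set ℤ} {n : ℤ} (hn : n ∈ Λ) (c : ℂ) :
    c • fourierBasis (T := 1) n ∈ spectralSubspace Λ := by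
  classical
  intro m hm
  have hmn : m ≠ n := fun h => hm (h ▸ hn)
  rw [map_smul, HilbertBasis.repr_self]
  simp [lp.single_apply, hmn]

lemma eq_zero_of_mem_spectralSubspace {Λ : Set ℤ}
    {g : Lp ℂ 2 (haarAddCircle : Measure UnitAddCircle)} (hg : g ∈ spectralSubspace Λ)
    (h : ∀ n ∈ Λ, inner ℂ (fourierBasis n) g = 0) : g = 0 := by
  refine fourierBasis.repr.injective (lp.ext (funext fun n => ?_))
  by_cases hn : n ∈ Λ
  · rw [HilbertBasis.repr_apply_apply, h n hn]
    simp
  · rw [hg n hn]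
    simp

lemma exists_hilbertBasis_spectralSubspace {ι : Type*} {Λ : Set ℤ} (e : ι → ℤ)
    (he : Function.Injective e) (hr : range e = Λ) (c : ι → ℂ) (hc : ∀ i, ‖c i‖ = 1) :
    ∃ b : HilbertBasis ι ℂ (spectralSubspace Λ), ∀ i,
      (b i : Lp ℂ 2 (haarAddCircle : Measure UnitAddCircle)) = c i • fourierBasis (e i) := by
  let v (i : ι) : spectralSubspace Λ :=
    ⟨_, smul_fourierBasis_mem_spectralSubspace (hr ▸ mem_range_self i : e i ∈ Λ) (c i)⟩
  have hv : Orthonormal ℂ v :=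
    (orthonormal_smul_comp fourierBasis.orthonormal he hc).codRestrict _ fun i => (v i).2
  refine ⟨HilbertBasis.mkOfOrthogonalEqBot hv ?_, fun i => ?_⟩
  · refine (Submodule.eq_bot_iff _).2 fun g hg =>
      Subtype.ext (eq_zero_of_mem_spectralSubspace g.2 fun n hn => ?_)
    obtain ⟨i, rfl⟩ : n ∈ range e := hr ▸ hn
    have horth : inner ℂ (c i • fourierBasis (T := 1) (e i)) (g : Lp ℂ 2 haarAddCircle) = 0 :=
      (Submodule.mem_orthogonal _ _).1 hg (v i) (Submodule.subset_span (mem_range_self i))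
    have hci : c i ≠ 0 := norm_ne_zero_iff.1 (by rw [hc]; exact one_ne_zero)
    rw [inner_smul_left] at horth
    exact (mul_eq_zero.1 horth).resolve_left ((map_ne_zero _).2 hci)
  · rw [HilbertBasis.coe_mkOfOrthogonalEqBot]

section Restriction

variable {X : Type*} [MeasurableSpace X] {ν : Measure X} {S : Set UnitAddCircle}
  {Z : Lp ℂ 2 (haarAddCircle : Measure UnitAddCircle) →L[ℂ] Lp ℂ 2 ν}

lemma compLp_eq_zero_iff {φ : X → UnitAddCircle}
    (hφ : ∀ P : UnitAddCircle → Prop,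
      (∀ᵐ y ∂ν, P (φ y)) ↔ ∀ᵐ x ∂(haarAddCircle : Measure UnitAddCircle), x ∈ S → P x)
    (hZ : ∀ g, Z g =ᵐ[ν] fun y => g (φ y))
    (g : Lp ℂ 2 (haarAddCircle : Measure UnitAddCircle)) :
    Z g = 0 ↔ ∀ᵐ x ∂haarAddCircle, x ∈ S → g x = 0 := by
  rw [← hφ fun x => g x = 0, Lp.eq_zero_iff_ae_eq_zero]
  exact eventually_congr ((hZ g).mono fun y hy => by rw [hy, Pi.zero_apply])

variable {Λ : Set ℤ} (hZ : ∀ g, Z g = 0 ↔ ∀ᵐ x ∂haarAddCircle, x ∈ S → g x = 0)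
include hZ

lemma isRieszSpectrum_of_bijective
    (h : Function.Bijective (Z.comp (spectralSubspace Λ).subtypeL)) : IsRieszSpectrum Λ S := by
  constructor
  · intro G hG
    obtain ⟨g, hg⟩ := h.2 (Z hG.toLp)
    have hsub : Z ((g : Lp ℂ 2 haarAddCircle) - hG.toLp) = 0 := by
      rw [map_sub, sub_eq_zero]
      exact hg
    refine ⟨_, hasSpectrumIn_of_mem g.2, ?_⟩
    filter_upwards [(hZ _).1 hsub, Lp.coeFn_sub (g : Lp ℂ 2 haarAddCircle) hG.toLp,
      hG.coeFn_toLp] with x hzero hcoe hGx hx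
    have hdiff := hzero hx
    rwa [hcoe, Pi.sub_apply, hGx, sub_eq_zero] at hdiff
  · intro g hg h0
    have hZg : Z hg.1.toLp = 0 := by
      rw [hZ]
      filter_upwards [h0, hg.1.coeFn_toLp] with x hx hcoe hxS
      rw [hcoe, hx hxS]
    have hsub : (⟨hg.1.toLp, hg.toLp_mem⟩ : spectralSubspace Λ) = 0 := h.1 (by simpa using hZg)
    have hzero : hg.1.toLp = 0 := congrArg Subtype.val hsub
    exact hg.1.coeFn_toLp.symm.trans (by rw [hzero]; exact Lp.coeFn_zero _ _ _)

lemma IsRieszSpectrum.bijective (h : IsRieszSpectrum Λ S) (hs : Function.Surjective Z) :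
    Function.Bijective (Z.comp (spectralSubspace Λ).subtypeL) := by
  constructor
  · rw [injective_iff_map_eq_zero]
    intro g hg
    have hzero := h.2 _ (hasSpectrumIn_of_mem g.2) ((hZ g).1 hg)
    exact Subtype.ext (Lp.ext (hzero.trans (Lp.coeFn_zero ℂ 2 haarAddCircle).symm))
  · intro F
    obtain ⟨G, rfl⟩ := hs F
    obtain ⟨g, hg, hgG⟩ := h.1 G (Lp.memLp G)
    refine ⟨⟨_, hg.toLp_mem⟩, ?_⟩
    change Z hg.1.toLp = Z G
    rw [← sub_eq_zero, ← map_sub, hZ]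
    filter_upwards [hgG, hg.1.coeFn_toLp, Lp.coeFn_sub hg.1.toLp G] with x heq hcoe hsub hx
    rw [hsub, Pi.sub_apply, hcoe, heq hx, sub_self]

end Restriction

/-! ### Perturbation of the trigonometric system -/

lemma bijective_of_norm_sub_le {𝕜 H K : Type*} [RCLike 𝕜] [NormedAddCommGroup H]
    [NormedSpace 𝕜 H] [NormedAddCommGroup K] [NormedSpace 𝕜 K] [CompleteSpace K]
    (U : H ≃ₗᵢ[𝕜] K) (W : H →L[𝕜] K) {q : ℝ} (hq0 : 0 ≤ q) (hq : q < 1)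
    (h : ∀ v, ‖W v - U v‖ ≤ q * ‖v‖) : Function.Bijective W := by
  let X : K →L[𝕜] K := 1 - W.comp (U.symm.toContinuousLinearEquiv : K →L[𝕜] H)
  have hX : ‖X‖ ≤ q := by
    refine ContinuousLinearMap.opNorm_le_bound _ hq0 fun v => ?_
    have hv := h (U.symm v)
    rwa [U.apply_symm_apply, U.symm.norm_map, norm_sub_rev] at hv
  have hbij := ContinuousLinearMap.isUnit_iff_bijective.1
    (isUnit_one_sub_of_norm_lt_one (hX.trans_lt hq))
  have hW : (W : H → K) = (1 - X : K →L[𝕜] K) ∘ U := by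
    ext v
    simp [X]
  rw [hW]
  exact hbij.comp U.bijective

lemma norm_sq_sum_smul_of_orthonormal {𝕜 E ι : Type*} [RCLike 𝕜] [NormedAddCommGroup E]
    [InnerProductSpace 𝕜 E] {v : ι → E} (hv : Orthonormal 𝕜 v) (s : Finset ι) (a : ι → 𝕜) :
    ‖∑ k ∈ s, a k • v k‖ ^ 2 = ∑ k ∈ s, ‖a k‖ ^ 2 := by
  simpa using hv.orthogonalFamily.norm_sum a s

/-- The Paley–Wiener criterion: the `W (b k)` form a Riesz basis when they are close to an
orthonormal basis. -/
lemma bijective_of_norm_sq_sum_sub_le {𝕜 H K ι : Type*} [RCLike 𝕜] [NormedAddCommGroup H]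
    [InnerProductSpace 𝕜 H] [NormedAddCommGroup K] [InnerProductSpace 𝕜 K] [CompleteSpace K]
    (b : HilbertBasis ι 𝕜 H) (b' : HilbertBasis ι 𝕜 K) (W : H →L[𝕜] K) {q : ℝ} (hq0 : 0 ≤ q)
    (hq : q < 1)
    (h : ∀ (s : Finset ι) (a : ι → 𝕜),
      ‖∑ k ∈ s, a k • (W (b k) - b' k)‖ ^ 2 ≤ q ^ 2 * ∑ k ∈ s, ‖a k‖ ^ 2) :
    Function.Bijective W := by
  classical
  let U : H ≃ₗᵢ[𝕜] K := b.repr.trans b'.repr.symm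
  have hU (k : ι) : U (b k) = b' k := by
    rw [LinearIsometryEquiv.trans_apply, b.repr_self, HilbertBasis.repr_symm_single]
  refine bijective_of_norm_sub_le U W hq0 hq fun v => ?_
  have hclosed : IsClosed {v | ‖W v - U v‖ ≤ q * ‖v‖} :=
    isClosed_le (W.continuous.sub U.continuous).norm (continuous_const.mul continuous_norm)
  refine hclosed.mem_of_tendsto (b.hasSum_repr v) (Eventually.of_forall fun s => ?_)
  have hsub (a : ι → 𝕜) : W (∑ k ∈ s, a k • b k) - U (∑ k ∈ s, a k • b k) =
      ∑ k ∈ s, a k • (W (b k) - b' k) := by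
    simp only [map_sum, map_smul, hU, smul_sub, Finset.sum_sub_distrib]
  refine (sq_le_sq₀ (norm_nonneg _) (by positivity)).1 ?_
  rw [mul_pow, norm_sq_sum_smul_of_orthonormal b.orthonormal, hsub]
  exact h s _

lemma norm_sq_eq_integral_norm_sq {X E : Type*} [MeasurableSpace X] {ν : Measure X}
    [NormedAddCommGroup E] [InnerProductSpace ℂ E] (F : Lp E 2 ν) :
    ‖F‖ ^ 2 = ∫ y, ‖F y‖ ^ 2 ∂ν := by
  have h := inner_self_eq_norm_sq_to_K (𝕜 := ℂ) F
  rw [L2.inner_def] at h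
  simp only [inner_self_eq_norm_sq_to_K, Complex.coe_algebraMap, ← Complex.ofReal_pow] at h
  rw [integral_complex_ofReal] at h
  exact_mod_cast h.symm

lemma coeFn_sum_smul {X ι 𝕜 E : Type*} [MeasurableSpace X] {ν : Measure X} [NormedRing 𝕜]
    [NormedAddCommGroup E] [Module 𝕜 E] [IsBoundedSMul 𝕜 E] {q : ℝ≥0∞} (s : Finset ι)
    (a : ι → 𝕜) (v : ι → Lp E q ν) :
    (∑ k ∈ s, a k • v k : Lp E q ν) =ᵐ[ν] fun y => ∑ k ∈ s, a k • v k y := by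
  have hsmul : ∀ᵐ y ∂ν, ∀ k ∈ s, (a k • v k : Lp E q ν) y = a k • v k y :=
    (eventually_all_finset s).2 fun k _ => Lp.coeFn_smul (a k) (v k)
  filter_upwards [Lp.coeFn_finsetSum s fun k => a k • v k, hsmul] with y hsum hy
  rw [hsum, Finset.sum_apply]
  exact Finset.sum_congr rfl hy

lemma fourierBasis_ae_eq (k : ℤ) :
    (fourierBasis (T := 1) k : Lp ℂ 2 haarAddCircle) =ᵐ[haarAddCircle] fourier k := by
  rw [coe_fourierBasis]
  exact coeFn_fourierLp 2 k

lemma integral_norm_sq_sum_mul_fourier (s : Finset ℤ) (a : ℤ → ℂ) :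
    ∫ y : UnitAddCircle, ‖∑ k ∈ s, a k * fourier k y‖ ^ 2 ∂haarAddCircle = ∑ k ∈ s, ‖a k‖ ^ 2 := by
  rw [← norm_sq_sum_smul_of_orthonormal (fourierBasis (T := 1)).orthonormal,
    norm_sq_eq_integral_norm_sq]
  refine integral_congr_ae ?_
  filter_upwards [coeFn_sum_smul s a (fourierBasis (T := 1)), ae_all_iff.2 fourierBasis_ae_eq]
    with y hsum hbasis
  simp only [hsum, hbasis, smul_eq_mul]

lemma norm_sq_sub_le_integral_norm_sq_deriv {E : Type*} [NormedAddCommGroup E] [NormedSpace ℝ E]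
    [CompleteSpace E] {f f' : ℝ → E} (hf : ∀ r, HasDerivAt f (f' r) r) (hf' : Continuous f')
    {ρ : ℝ} (hρ : ρ ∈ Icc (0 : ℝ) 1) : ‖f ρ - f 0‖ ^ 2 ≤ ∫ r in Ioc (0 : ℝ) 1, ‖f' r‖ ^ 2 := by
  have : IsProbabilityMeasure (volume.restrict (Ioc (0 : ℝ) 1)) := ⟨by simp⟩
  have hint {g : ℝ → ℝ} (hg : Continuous g) : Integrable g (volume.restrict (Ioc (0 : ℝ) 1)) :=
    hg.integrableOn_Ioc
  have hle : ‖f ρ - f 0‖ ≤ ∫ r in Ioc (0 : ℝ) 1, ‖f' r‖ := by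
    rw [← intervalIntegral.integral_eq_sub_of_hasDerivAt (fun r _ => hf r)
      (hf'.intervalIntegrable 0 ρ), ← intervalIntegral.integral_of_le zero_le_one]
    exact (intervalIntegral.norm_integral_le_integral_norm hρ.1).trans
      (intervalIntegral.integral_mono_interval le_rfl hρ.1 hρ.2
        (Eventually.of_forall fun r => norm_nonneg _) (hf'.norm.intervalIntegrable _ _))
  calc ‖f ρ - f 0‖ ^ 2 ≤ (∫ r in Ioc (0 : ℝ) 1, ‖f' r‖) ^ 2 := by gcongr
    _ ≤ ∫ r in Ioc (0 : ℝ) 1, ‖f' r‖ ^ 2 :=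
      even_two.convexOn_pow.map_integral_le (by fun_prop) isClosed_univ (by simp) (hint hf'.norm)
        (hint (hf'.norm.pow 2))

lemma hasDerivAt_sum_mul_fourierChar {ι : Type*} (s : Finset ι) (a : ι → ℂ) (d : ι → ℝ) (r : ℝ) :
    HasDerivAt (fun r : ℝ => ∑ k ∈ s, a k * (𝐞 (d k * r) : ℂ))
      (∑ k ∈ s, a k * (2 * Real.pi * Complex.I * d k * 𝐞 (d k * r))) r := by
  refine HasDerivAt.fun_sum fun k _ => HasDerivAt.const_mul _ ?_
  have hcomp := (Real.hasDerivAt_fourierChar (d k * r)).scomp r ((hasDerivAt_id r).const_mul (d k))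
  refine hcomp.congr_deriv ?_
  rw [mul_one, Complex.real_smul]
  ring

lemma integrable_uncurry_of_continuous {X E : Type*} [TopologicalSpace X] [CompactSpace X]
    [T2Space X] [SecondCountableTopology X] [MeasurableSpace X] [OpensMeasurableSpace X]
    {μ : Measure X} [IsFiniteMeasure μ] [NormedAddCommGroup E] [SecondCountableTopology E]
    {Ψ : X → ℝ → E} (hΨ : Continuous (Function.uncurry Ψ)) (a b : ℝ) :
    Integrable (Function.uncurry Ψ) (μ.prod (volume.restrict (Ioc a b))) := by
  have hcompact : IsCompact ((univ : Set X) ×ˢ Icc a b) := isCompact_univ.prod isCompact_Icc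
  rw [← Measure.restrict_univ (μ := μ), Measure.prod_restrict]
  exact (hΨ.continuousOn.integrableOn_compact hcompact).mono_set
    (prod_mono le_rfl Ioc_subset_Icc_self)

lemma integral_norm_sq_sum_mul_sub_one_le (s : Finset ℤ) (d : ℤ → ℝ) (c : ℤ → ℂ) {η : ℝ}
    (hd : ∀ k, |d k| ≤ η) :
    ∫ y : UnitAddCircle, ‖∑ k ∈ s, c k * fourier k y * ((𝐞 (d k * circleRep 0 y) : ℂ) - 1)‖ ^ 2
      ∂haarAddCircle ≤ (2 * Real.pi * η) ^ 2 * ∑ k ∈ s, ‖c k‖ ^ 2 := by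
  let Ψ (y : UnitAddCircle) (r : ℝ) : ℝ :=
    ‖∑ k ∈ s, c k * fourier k y * (2 * Real.pi * Complex.I * d k * 𝐞 (d k * r))‖ ^ 2
  have hint : Integrable (Function.uncurry Ψ)
      ((haarAddCircle : Measure UnitAddCircle).prod (volume.restrict (Ioc (0 : ℝ) 1))) :=
    integrable_uncurry_of_continuous (by unfold Function.uncurry; fun_prop) 0 1
  have hpointwise (y : UnitAddCircle) :
      ‖∑ k ∈ s, c k * fourier k y * ((𝐞 (d k * circleRep 0 y) : ℂ) - 1)‖ ^ 2 ≤
        ∫ r in Ioc (0 : ℝ) 1, Ψ y r := by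
    have h := norm_sq_sub_le_integral_norm_sq_deriv
      (hasDerivAt_sum_mul_fourierChar s (fun k => c k * fourier k y) d) (by fun_prop)
      (Ioc_subset_Icc_self (by simpa using circleRep_mem_Ioc 0 y))
    simpa only [mul_sub, mul_zero, mul_one, AddChar.map_zero_eq_one, Circle.coe_one,
      Finset.sum_sub_distrib] using h
  have hmean (r : ℝ) :
      ∫ y, Ψ y r ∂haarAddCircle = ∑ k ∈ s, (2 * Real.pi * |d k|) ^ 2 * ‖c k‖ ^ 2 := by
    have h := integral_norm_sq_sum_mul_fourier s
      fun k => c k * (2 * Real.pi * Complex.I * d k * 𝐞 (d k * r))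
    simp only [Ψ, mul_right_comm _ (fourier _ _ : ℂ), h]
    refine Finset.sum_congr rfl fun k _ => ?_
    simp only [norm_mul, Circle.norm_coe, Complex.norm_I, Complex.norm_real, Real.norm_eq_abs,
      Complex.norm_ofNat, abs_of_pos Real.pi_pos]
    ring
  calc
    _ ≤ ∫ y : UnitAddCircle, (∫ r in Ioc (0 : ℝ) 1, Ψ y r) ∂haarAddCircle :=
        integral_mono_of_nonneg (Eventually.of_forall fun y => sq_nonneg _)
          hint.integral_prod_left (Eventually.of_forall hpointwise)
    _ = ∫ _ in Ioc (0 : ℝ) 1, ∑ k ∈ s, (2 * Real.pi * |d k|) ^ 2 * ‖c k‖ ^ 2 := by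
        rw [integral_integral_swap hint]
        simp_rw [hmean]
    _ = ∑ k ∈ s, (2 * Real.pi * |d k|) ^ 2 * ‖c k‖ ^ 2 := by simp
    _ ≤ (2 * Real.pi * η) ^ 2 * ∑ k ∈ s, ‖c k‖ ^ 2 := by
        rw [Finset.mul_sum]
        gcongr with k
        exact hd k

lemma norm_sq_sum_smul_sub_fourierBasis_le {v : ℤ → Lp ℂ 2 (haarAddCircle : Measure UnitAddCircle)}
    {d : ℤ → ℝ} {η : ℝ} (hd : ∀ k, |d k| ≤ η)
    (hv : ∀ k, v k =ᵐ[haarAddCircle] fun y => fourier k y * 𝐞 (d k * circleRep 0 y))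
    (s : Finset ℤ) (a : ℤ → ℂ) :
    ‖∑ k ∈ s, a k • (v k - fourierBasis k)‖ ^ 2 ≤
      (2 * Real.pi * η) ^ 2 * ∑ k ∈ s, ‖a k‖ ^ 2 := by
  rw [norm_sq_eq_integral_norm_sq]
  refine (integral_congr_ae ?_).trans_le (integral_norm_sq_sum_mul_sub_one_le s d a hd)
  filter_upwards [coeFn_sum_smul s a fun k => v k - fourierBasis k, ae_all_iff.2 hv,
    ae_all_iff.2 fun k => Lp.coeFn_sub (v k) (fourierBasis k), ae_all_iff.2 fourierBasis_ae_eq]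
    with y hsum hvy hsub hbasis
  simp only [hsum, hsub, Pi.sub_apply, hvy, hbasis, smul_eq_mul, mul_sub, mul_one, mul_assoc]

/-! ### Short arcs -/

lemma abs_round_div_mul_sub_le {δ : ℝ} (hδ : 0 < δ) (x : ℝ) :
    |round (x / δ) * δ - x| ≤ δ / 2 := by
  have h := abs_sub_round (x / δ)
  have hx : round (x / δ) * δ - x = -((x / δ - round (x / δ)) * δ) := by
    rw [sub_mul, div_mul_cancel₀ _ hδ.ne', neg_sub]
  rw [hx, abs_neg, abs_mul, abs_of_pos hδ]
  linarith [mul_le_mul_of_nonneg_right h hδ.le]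

lemma injective_round_intCast_div {δ : ℝ} (hδ : 0 < δ) (hδ1 : δ < 1) :
    Function.Injective fun k : ℤ => round ((k : ℝ) / δ) := by
  intro k l hkl
  have hk := abs_le.1 (abs_round_div_mul_sub_le hδ k)
  have hl := abs_le.1 (abs_round_div_mul_sub_le hδ l)
  dsimp only at hkl
  rw [hkl] at hk
  have hdist : |((k - l : ℤ) : ℝ)| < 1 := by
    rw [abs_lt]
    push_cast
    constructor <;> linarith
  have hdist' : |k - l| < 1 := by exact_mod_cast hdist
  exact sub_eq_zero.1 (Int.abs_lt_one_iff.1 hdist')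

lemma fourier_coe_eq_fourierChar (k : ℤ) (t : ℝ) :
    fourier k (t : UnitAddCircle) = (𝐞 (k * t) : ℂ) := by
  rw [fourier_coe_apply, Real.fourierChar_apply]
  congr 1
  push_cast
  ring

lemma ae_branch_iff_ae_mem_arc {p δ : ℝ} (hδ : 0 < δ) (hδ1 : δ ≤ 1) {S : Set UnitAddCircle}
    (hS : ∀ t : ℝ, (t : UnitAddCircle) ∈ S ↔ Int.fract (t - p) < δ) (P : UnitAddCircle → Prop) :
    (∀ᵐ y ∂(haarAddCircle : Measure UnitAddCircle), P (branch p δ y)) ↔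
      ∀ᵐ x ∂(haarAddCircle : Measure UnitAddCircle), x ∈ S → P x := by
  rw [ae_branch_iff hδ p, ae_circle_iff_Ioc p]
  refine eventually_congr ?_
  filter_upwards [Measure.ae_ne volume (p + δ), Measure.ae_ne volume (p + 1)] with t hne hne'
  rw [hS, ← and_imp]
  refine imp_congr_left ⟨fun ht => ?_, fun ht => ?_⟩
  · have hlt := lt_of_le_of_ne ht.2 hne
    rw [Int.fract_eq_self.2 ⟨by linarith [ht.1], by linarith⟩]
    exact ⟨⟨ht.1, by linarith⟩, by linarith⟩
  · obtain ⟨ht, hfract⟩ := ht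
    have hlt := lt_of_le_of_ne ht.2 hne'
    rw [Int.fract_eq_self.2 ⟨by linarith [ht.1], by linarith⟩] at hfract
    exact ⟨ht.1, by linarith⟩

theorem exists_isRieszSpectrum_arc {p δ : ℝ} (hδ : 0 < δ) (hδ' : δ ≤ 1 / 4)
    {S : Set UnitAddCircle} (hS : ∀ t : ℝ, (t : UnitAddCircle) ∈ S ↔ Int.fract (t - p) < δ) :
    ∃ Λ, IsRieszSpectrum Λ S := by
  let n (k : ℤ) : ℤ := round ((k : ℝ) / δ)
  let d (k : ℤ) : ℝ := n k * δ - k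
  have hd (k : ℤ) : |d k| ≤ δ / 2 := abs_round_div_mul_sub_le hδ k
  -- The phases make the pullback of `b k` to `(0, 1]` equal to `t ↦ e^{2πi(k + d k)t}`.
  obtain ⟨b, hb⟩ := exists_hilbertBasis_spectralSubspace n
    (injective_round_intCast_div hδ (by linarith)) rfl (fun k => (𝐞 (-(n k * p)) : ℂ))
    fun k => Circle.norm_coe _
  obtain ⟨Z, hZ⟩ := exists_compLp_of_map_le_smul (𝕜 := ℂ) (E := ℂ) (q := 2) (by finiteness)
    (measurable_branch p δ) ENNReal.ofReal_ne_top (map_branch_le hδ (by linarith) p)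
  refine ⟨range n, isRieszSpectrum_of_bijective
    (compLp_eq_zero_iff (ae_branch_iff_ae_mem_arc hδ (by linarith) hS) hZ) ?_⟩
  have hW (k : ℤ) : Z (b k) =ᵐ[haarAddCircle] fun y =>
      fourier k y * 𝐞 (d k * circleRep 0 y) := by
    have hsmul := Lp.coeFn_smul (𝐞 (-(n k * p)) : ℂ) (fourierBasis (T := 1) (n k))
    rw [← hb] at hsmul
    filter_upwards [hZ (b k), ae_branch_of_ae hδ p hsmul,
      ae_branch_of_ae hδ p (fourierBasis_ae_eq (n k))] with y hZy hby hfourier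
    rw [hZy, hby, Pi.smul_apply, hfourier, branch, fourier_coe_eq_fourierChar, smul_eq_mul,
      ← coe_fourierChar_add]
    conv_rhs =>
      rw [← coe_circleRep 0 y, fourier_coe_eq_fourierChar, coe_circleRep, ← coe_fourierChar_add]
    congr 2
    simp only [d]
    ring
  have hq : 2 * Real.pi * (δ / 2) < 1 := by nlinarith [Real.pi_lt_four]
  exact bijective_of_norm_sq_sum_sub_le b fourierBasis _ (by positivity) hq
    (norm_sq_sum_smul_sub_fourierBasis_le hd hW)

/-! ### Riesz spectra of finite unions of arcs -/

open Classical in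
/-- The indicator function of a set of points of the circle, as a `1`-periodic function on the
line. It takes values in `ℤ` so that it can be compared with sums of floors. -/
noncomputable def circleIndicator (S : Set UnitAddCircle) (t : ℝ) : ℤ :=
  if (t : UnitAddCircle) ∈ S then 1 else 0

lemma coe_eq_coe_iff_exists_int {s t : ℝ} :
    (t : UnitAddCircle) = s ↔ ∃ m : ℤ, t = s + m := by
  rw [← sub_eq_zero, ← AddCircle.coe_sub, AddCircle.coe_eq_zero_iff]
  refine exists_congr fun m => ?_
  rw [zsmul_one, eq_comm, sub_eq_iff_eq_add']

lemma periodic_circleIndicator (S : Set UnitAddCircle) :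
    Function.Periodic (circleIndicator S) 1 := fun t => by
  rw [circleIndicator, circleIndicator, AddCircle.coe_add_period]

lemma measurableSet_of_isFloorSum {L : ℕ} {S : Set UnitAddCircle}
    (h : IsFloorSum L (circleIndicator S)) : MeasurableSet S := by
  obtain ⟨c, a, b, h⟩ := h
  have hmeas : Measurable (circleIndicator S) := by
    rw [funext h]
    exact (measurable_floorSum L a b).const_add _
  have hS : S = circleRep 0 ⁻¹' (circleIndicator S ⁻¹' {1}) := by
    ext x
    simp [circleIndicator]
  rw [hS]
  exact (measurableEmbedding_circleRep 0).measurable (hmeas (measurableSet_singleton 1))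

lemma periodic_sum_fibre {M : Type*} [AddCommMonoid M] {f : ℝ → M} (hf : Function.Periodic f 1)
    {N : ℕ} (hN : 0 < N) :
    Function.Periodic (fun t => ∑ j ∈ Finset.range N, f ((t + j) / N)) 1 := by
  intro t
  obtain ⟨n, rfl⟩ := Nat.exists_eq_add_one.2 hN
  have hshift (j : ℕ) : t + 1 + j = t + (j + 1 : ℕ) := by
    push_cast
    ring
  have hlast : f ((t + (n + 1 : ℕ)) / (n + 1 : ℕ)) = f ((t + (0 : ℕ)) / (n + 1 : ℕ)) := by
    rw [add_div, div_self (Nat.cast_ne_zero.2 n.succ_ne_zero), hf, Nat.cast_zero, add_zero]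
  simp only [hshift]
  rw [Finset.sum_range_succ, hlast, Finset.sum_range_succ' fun j : ℕ => f ((t + j) / (n + 1 : ℕ))]

lemma card_fibreIdx_coe {N : ℕ} (hN : 0 < N) (S : Set UnitAddCircle) (t : ℝ) :
    ((fibreIdx N S (t : UnitAddCircle)).card : ℤ) =
      ∑ j ∈ Finset.range N, circleIndicator S ((t + j) / N) := by
  let s := circleRep 0 (t : UnitAddCircle)
  have hfibre (j : ℕ) : fibrePt N j t = (((s + j) / N : ℝ) : UnitAddCircle) := by
    rw [fibrePt, branch]
    congr 1
    ring
  obtain ⟨m, hm⟩ := coe_eq_coe_iff_exists_int.1 (coe_circleRep 0 (t : UnitAddCircle)).symm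
  have hperiodic := (periodic_sum_fibre (periodic_circleIndicator S) hN).int_mul m s
  rw [mul_one, ← hm] at hperiodic
  rw [hperiodic, fibreIdx, Finset.card_filter, Nat.cast_sum]
  refine Finset.sum_congr rfl fun j _ => ?_
  rw [circleIndicator, Nat.cast_ite, Nat.cast_one, Nat.cast_zero, hfibre]

lemma circleIndicator_lt_card_fibreIdx {N : ℕ} (hN : 0 < N) (S : Set UnitAddCircle) (n : ℕ)
    (t : ℝ) : circleIndicator {y | n < (fibreIdx N S y).card} t =
      if (n : ℤ) + 1 ≤ ∑ j ∈ Finset.range N, circleIndicator S ((t + j) / N) then 1 else 0 := by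
  rw [← card_fibreIdx_coe hN, circleIndicator]
  congr 1
  rw [mem_ofPred_eq, Int.add_one_le_iff, Nat.cast_lt]

lemma fract_le_of_eq_intCast_add {x e : ℝ} {m : ℤ} (hx : x = m + e) (he : 0 ≤ e) :
    Int.fract x ≤ e := by
  rw [hx, Int.fract_intCast_add, ← Int.self_sub_floor, sub_le_self_iff]
  exact_mod_cast Int.floor_nonneg.2 he

lemma exists_fract_mul_le (β : ℝ) {ε : ℝ} (hε : 0 < ε) :
    ∃ N : ℕ, 0 < N ∧ Int.fract (N * β) ≤ ε := by
  obtain ⟨n, hn⟩ := exists_nat_one_div_lt hε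
  obtain ⟨k, hk, -, hround⟩ := Real.exists_nat_abs_mul_sub_round_le β n.succ_pos
  let e : ℝ := k * β - round (k * β)
  have hkβ : k * β = round (k * β) + e := (add_sub_cancel _ _).symm
  have he : |e| ≤ ε := by
    refine hround.trans ((one_div_le_one_div_of_le (by positivity) ?_).trans hn.le)
    push_cast
    linarith
  rcases le_or_gt 0 e with h0 | h0
  · exact ⟨k, hk, (fract_le_of_eq_intCast_add hkβ h0).trans ((le_abs_self e).trans he)⟩
  · rw [abs_of_neg h0] at he
    obtain ⟨m, ⟨hm, hm'⟩, -⟩ := existsUnique_add_zsmul_mem_Ico (neg_pos.2 h0) (-1) e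
    rw [zsmul_eq_mul] at hm hm'
    have hm0 : 0 < m := by
      by_contra! hle
      have hprod : (m : ℝ) * -e ≤ 0 :=
        mul_nonpos_of_nonpos_of_nonneg (by exact_mod_cast hle) (neg_nonneg.2 h0.le)
      linarith [(abs_le.1 (abs_sub_round (k * β))).1]
    lift m to ℕ using hm0.le
    refine ⟨m * k, Nat.mul_pos (by exact_mod_cast hm0) hk, ?_⟩
    rw [Int.cast_natCast] at hm hm'
    refine (fract_le_of_eq_intCast_add (m := m * round (k * β) - 1) (e := 1 + m * e) ?_
      (by linarith)).trans (by linarith)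
    push_cast
    linear_combination m * hkβ

lemma floor_sub_floor_sub {x δ : ℝ} (hδ0 : 0 ≤ δ) (hδ1 : δ ≤ 1) :
    ⌊x⌋ - ⌊x - δ⌋ = if Int.fract x < δ then 1 else 0 := by
  have hx := Int.floor_add_fract x
  have hfract0 := Int.fract_nonneg x
  have hfract1 := Int.fract_lt_one x
  split_ifs with h
  · have hfloor : ⌊x - δ⌋ = ⌊x⌋ - 1 := by
      rw [Int.floor_eq_iff]
      push_cast
      constructor <;> linarith
    omega
  · have hfloor : ⌊x - δ⌋ = ⌊x⌋ := by
      rw [Int.floor_eq_iff]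
      constructor <;> linarith
    omega

lemma exists_isRieszSpectrum_of_fold {N : ℕ} (hN : 0 < N) {S : Set UnitAddCircle}
    (hS : MeasurableSet S)
    (h : ∀ n : ℕ, ∃ Λ, IsRieszSpectrum Λ {y | n < (fibreIdx N S y).card}) :
    ∃ Λ, IsRieszSpectrum Λ S := by
  choose Λ hΛ using h
  exact ⟨_, IsRieszSpectrum.combine hN hS fun n _ => hΛ n⟩

lemma exists_isRieszSpectrum_of_lt_add_ite {p δ : ℝ} (hδ0 : 0 ≤ δ) (hδ : δ ≤ 1 / 4) {k n : ℤ}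
    {S : Set UnitAddCircle}
    (hS : ∀ t : ℝ, (t : UnitAddCircle) ∈ S ↔ n < k + if Int.fract (t - p) < δ then 1 else 0) :
    ∃ Λ, IsRieszSpectrum Λ S := by
  have hempty (h : ∀ t : ℝ, (t : UnitAddCircle) ∉ S) : ∃ Λ, IsRieszSpectrum Λ S := by
    have hS : S = ∅ := eq_empty_of_forall_notMem fun y => coe_circleRep 0 y ▸ h _
    exact ⟨_, hS ▸ isRieszSpectrum_empty⟩
  rcases lt_trichotomy n k with hlt | rfl | hgt
  · have huniv : S = univ := by
      refine eq_univ_of_forall fun y => ?_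
      rw [← coe_circleRep 0 y, hS]
      split_ifs <;> omega
    exact ⟨_, huniv ▸ isRieszSpectrum_univ⟩
  · rcases hδ0.eq_or_lt with rfl | hpos
    · exact hempty fun t => by simp [hS, (Int.fract_nonneg _).not_gt]
    · refine exists_isRieszSpectrum_arc hpos hδ (p := p) fun t => ?_
      rw [hS]
      split_ifs with h <;> simp [h]
  · refine hempty fun t => ?_
    rw [hS]
    split_ifs <;> omega

lemma exists_isRieszSpectrum_of_isFloorSum_one {S : Set UnitAddCircle}
    (h : IsFloorSum 1 (circleIndicator S)) : ∃ Λ, IsRieszSpectrum Λ S := by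
  have hmeas := measurableSet_of_isFloorSum h
  obtain ⟨c, a, b, h⟩ := h
  obtain ⟨N, hN, hle⟩ := exists_fract_mul_le (b 0 - a 0) (ε := 1 / 4) (by norm_num)
  have hδ := Int.floor_add_fract (N * (b 0 - a 0))
  set δ := Int.fract (N * (b 0 - a 0))
  set m := ⌊N * (b 0 - a 0)⌋
  have hδ0 : 0 ≤ δ := Int.fract_nonneg _
  refine exists_isRieszSpectrum_of_fold hN hmeas fun n =>
    exists_isRieszSpectrum_of_lt_add_ite (p := N * a 0) (k := N * c + m) (n := n) hδ0 hle
      fun t => ?_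
  have hb : t - N * b 0 = t - N * a 0 - δ - m := by linarith
  rw [mem_ofPred_eq, ← Nat.cast_lt (α := ℤ), card_fibreIdx_coe hN, sum_fibre_floorSum hN h,
    Finset.sum_range_one, ← floor_sub_floor_sub hδ0 (by linarith), hb, Int.floor_sub_intCast]
  ring_nf

theorem exists_isRieszSpectrum_of_isFloorSum {L : ℕ} {S : Set UnitAddCircle}
    (h : IsFloorSum L (circleIndicator S)) : ∃ Λ, IsRieszSpectrum Λ S := by
  suffices hsucc : ∀ (L : ℕ) (S : Set UnitAddCircle), IsFloorSum (L + 1) (circleIndicator S) →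
      ∃ Λ, IsRieszSpectrum Λ S from hsucc L S h.succ
  clear h
  intro L
  induction L with
  | zero => exact fun S h => exists_isRieszSpectrum_of_isFloorSum_one h
  | succ L ih =>
    intro S h
    obtain ⟨N, hN, hfold⟩ := h.exists_reducing_fold (by omega)
    refine exists_isRieszSpectrum_of_fold hN (measurableSet_of_isFloorSum h) fun n => ih _ ?_
    rw [funext (circleIndicator_lt_card_fibreIdx hN S n)]
    exact hfold _

lemma coe_mem_image_Ico_iff {a b : ℝ} (hb : b ≤ a + 1) (t : ℝ) :
    (t : UnitAddCircle) ∈ (fun s : ℝ => (s : UnitAddCircle)) '' Ico a b ↔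
      Int.fract (t - a) < b - a := by
  constructor
  · rintro ⟨s, hs, hst⟩
    obtain ⟨m, rfl⟩ := coe_eq_coe_iff_exists_int.1 hst.symm
    rw [add_sub_right_comm, Int.fract_add_intCast,
      Int.fract_eq_self.2 ⟨by linarith [hs.1], by linarith [hs.2]⟩]
    linarith [hs.2]
  · intro h
    refine ⟨a + Int.fract (t - a), ⟨by linarith [Int.fract_nonneg (t - a)], by linarith⟩, ?_⟩
    refine (coe_eq_coe_iff_exists_int.2 ⟨⌊t - a⌋, ?_⟩).symm
    linarith [Int.floor_add_fract (t - a)]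

lemma circleIndicator_arc {a b : ℝ} (hab : a ≤ b) (hb : b ≤ a + 1) (t : ℝ) :
    circleIndicator ((fun s : ℝ => (s : UnitAddCircle)) '' Ico a b) t = ⌊t - a⌋ - ⌊t - b⌋ := by
  rw [← sub_sub_sub_cancel_right t b a, floor_sub_floor_sub (by linarith) (by linarith),
    circleIndicator]
  simp only [coe_mem_image_Ico_iff hb]

lemma exists_isFloorSum_biUnion {ι : Type*} (s : Finset ι) {a b : ι → ℝ}
    (hab : ∀ i ∈ s, a i ≤ b i) (hb : ∀ i ∈ s, b i ≤ a i + 1) :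
    ∃ L, IsFloorSum L
      (circleIndicator (⋃ i ∈ s, (fun t : ℝ => (t : UnitAddCircle)) '' Ico (a i) (b i))) := by
  classical
  induction s using Finset.induction_on with
  | empty => exact ⟨0, 0, 0, 0, fun t => by simp [circleIndicator]⟩
  | insert i s _ ih =>
    rw [Finset.forall_mem_insert] at hab hb
    obtain ⟨L, hL⟩ := ih hab.2 hb.2
    have harc : IsFloorSum 1
        (circleIndicator ((fun t : ℝ => (t : UnitAddCircle)) '' Ico (a i) (b i))) :=
      ⟨0, fun _ => a i, fun _ => b i, fun t => by simp [circleIndicator_arc hab.1 hb.1]⟩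
    refine ⟨1 + L, ?_⟩
    convert (harc.add hL).superlevel 1 using 2 with t
    rw [Finset.set_biUnion_insert]
    simp only [circleIndicator, mem_union]
    split_ifs <;> simp_all

/-! ### Riesz bases of isomorphic images -/

section PolarDecomposition

variable {H K : Type*} [NormedAddCommGroup H] [InnerProductSpace ℂ H] [CompleteSpace H]
  [NormedAddCommGroup K] [InnerProductSpace ℂ K] [CompleteSpace K]

lemma norm_sqrt_adjoint_comp_self_apply (F : H →L[ℂ] K) (v : H) :
    ‖CFC.sqrt (F.adjoint.comp F) v‖ = ‖F v‖ := by
  have hpos : 0 ≤ F.adjoint.comp F :=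
    (ContinuousLinearMap.nonneg_iff_isPositive _).2 F.isPositive_adjoint_comp_self
  have hsymm : (CFC.sqrt (F.adjoint.comp F)).adjoint = CFC.sqrt (F.adjoint.comp F) :=
    (CFC.sqrt_nonneg (F.adjoint.comp F)).isSelfAdjoint
  have hinner : inner ℂ (CFC.sqrt (F.adjoint.comp F) v) (CFC.sqrt (F.adjoint.comp F) v) =
      inner ℂ (F v) (F v) := by
    rw [← ContinuousLinearMap.adjoint_inner_right, hsymm, ← mul_apply_eq_comp,
      CFC.sqrt_mul_sqrt_self _ hpos, ContinuousLinearMap.comp_apply,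
      ContinuousLinearMap.adjoint_inner_right]
  rw [inner_self_eq_norm_sq_to_K, inner_self_eq_norm_sq_to_K] at hinner
  exact (sq_eq_sq₀ (norm_nonneg _) (norm_nonneg _)).1 (by exact_mod_cast hinner)

lemma bijective_adjoint (Φ : H ≃L[ℂ] K) :
    Function.Bijective (Φ : H →L[ℂ] K).adjoint := by
  refine Function.bijective_iff_has_inverse.2 ⟨(Φ.symm : K →L[ℂ] H).adjoint, fun x => ?_,
    fun x => ?_⟩
  · rw [← ContinuousLinearMap.comp_apply, ← ContinuousLinearMap.adjoint_comp,
      Φ.coe_comp_coe_symm, ContinuousLinearMap.adjoint_id, ContinuousLinearMap.id_apply]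
  · rw [← ContinuousLinearMap.comp_apply, ← ContinuousLinearMap.adjoint_comp,
      Φ.coe_symm_comp_coe, ContinuousLinearMap.adjoint_id, ContinuousLinearMap.id_apply]

/-- The isometry is the unitary factor of the polar decomposition of `Φ`. -/
lemma nonempty_linearIsometryEquiv_of_continuousLinearEquiv (Φ : H ≃L[ℂ] K) :
    Nonempty (H ≃ₗᵢ[ℂ] K) := by
  let F : H →L[ℂ] K := Φ
  have hunit : IsUnit (CFC.sqrt (F.adjoint.comp F)) := by
    rw [CFC.isUnit_sqrt_iff _
      ((ContinuousLinearMap.nonneg_iff_isPositive _).2 F.isPositive_adjoint_comp_self),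
      ContinuousLinearMap.isUnit_iff_bijective]
    exact (bijective_adjoint Φ).comp Φ.bijective
  obtain ⟨u, hu⟩ := hunit
  let E : H ≃L[ℂ] H := ContinuousLinearEquiv.ofUnit u
  refine ⟨⟨(E.symm.trans Φ).toLinearEquiv, fun v => ?_⟩⟩
  have hE : CFC.sqrt (F.adjoint.comp F) (E.symm v) = v := by
    rw [← hu]
    exact E.apply_symm_apply v
  calc ‖F (E.symm v)‖ = ‖CFC.sqrt (F.adjoint.comp F) (E.symm v)‖ :=
        (norm_sqrt_adjoint_comp_self_apply F _).symm
    _ = ‖v‖ := by rw [hE]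

lemma isRieszBasis_of_equiv {ι : Type*} (b : HilbertBasis ι ℂ H) (Φ : H ≃L[ℂ] K) :
    IsRieszBasis fun i => Φ (b i) := by
  classical
  obtain ⟨V⟩ := nonempty_linearIsometryEquiv_of_continuousLinearEquiv Φ
  refine ⟨HilbertBasis.ofRepr (V.symm.trans b.repr), V.symm.toContinuousLinearEquiv.trans Φ,
    fun i => ?_⟩
  have hV : HilbertBasis.ofRepr (V.symm.trans b.repr) i = V (b i) := by
    rw [← HilbertBasis.repr_symm_single, ← b.repr_symm_single]
    rfl
  rw [hV]
  exact congrArg Φ (V.symm_apply_apply (b i)).symm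

end PolarDecomposition

/-! ### From the circle to the line -/

/-- The part in the period `(c, c + P]` of the set of reals `t` for which `t / P` represents a
point of `T`. -/
def periodLift (c P : ℝ) (T : Set UnitAddCircle) : Set ℝ :=
  Ioc c (c + P) ∩ (fun t : ℝ => ((t / P : ℝ) : UnitAddCircle)) ⁻¹' T

lemma periodLift_iUnion {ι : Sort*} (c P : ℝ) (T : ι → Set UnitAddCircle) :
    periodLift c P (⋃ i, T i) = ⋃ i, periodLift c P (T i) := by
  simp only [periodLift, preimage_iUnion, inter_iUnion]

lemma measurable_coe_div (P : ℝ) : Measurable fun t : ℝ => ((t / P : ℝ) : UnitAddCircle) :=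
  AddCircle.measurable_mk'.comp (measurable_id.div_const P)

lemma measurableSet_periodLift (c P : ℝ) {T : Set UnitAddCircle} (hT : MeasurableSet T) :
    MeasurableSet (periodLift c P T) :=
  measurableSet_Ioc.inter (measurable_coe_div P hT)

section PeriodLift

variable {c P : ℝ} (hP : 0 < P)
include hP

lemma div_mem_Ioc_iff {t : ℝ} : t / P ∈ Ioc (c / P) (c / P + 1) ↔ t ∈ Ioc c (c + P) := by
  rw [div_add_one hP.ne', mem_Ioc, mem_Ioc, div_lt_div_iff_of_pos_right hP,
    div_le_div_iff_of_pos_right hP]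

lemma div_mem_Ico_iff {a b t : ℝ} : t / P ∈ Ico (a / P) (b / P) ↔ t ∈ Ico a b := by
  rw [mem_Ico, mem_Ico, div_le_div_iff_of_pos_right hP, div_lt_div_iff_of_pos_right hP]

lemma ae_restrict_periodLift_iff {T : Set UnitAddCircle} (hT : MeasurableSet T)
    (Q : UnitAddCircle → Prop) :
    (∀ᵐ t ∂volume.restrict (periodLift c P T), Q ((t / P : ℝ) : UnitAddCircle)) ↔
      ∀ᵐ x ∂haarAddCircle, x ∈ T → Q x := by
  rw [ae_restrict_iff' (measurableSet_periodLift c P hT), ae_circle_iff_Ioc (c / P),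
    ← ae_comp_affine_iff (inv_ne_zero hP.ne') 0
      (P := fun s => s ∈ Ioc (c / P) (c / P + 1) → (s : UnitAddCircle) ∈ T → Q s)]
  simp only [zero_add, ← div_eq_inv_mul, div_mem_Ioc_iff hP, periodLift, mem_inter_iff,
    mem_preimage, and_imp]

lemma map_coe_div_restrict_periodLift_le (T : Set UnitAddCircle) :
    Measure.map (fun t : ℝ => ((t / P : ℝ) : UnitAddCircle))
      (volume.restrict (periodLift c P T)) ≤ ENNReal.ofReal P • haarAddCircle := by
  have hmap := map_affine_restrict_Ioc_le (inv_pos.2 hP) 0 c (l := P) (by simp [hP.ne'])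
  simp only [zero_add, ← div_eq_inv_mul, inv_inv] at hmap
  exact (Measure.map_mono (Measure.restrict_mono inter_subset_left le_rfl)
    (measurable_coe_div P)).trans hmap

lemma memLp_comp_mul_circleRep {E : Type*} [NormedAddCommGroup E] {q : ℝ≥0∞} {f : ℝ → E}
    (hf : MemLp f q volume) (a : ℝ) :
    MemLp (fun x => f (P * circleRep a x)) q haarAddCircle := by
  have hdilated : MemLp (fun s => f (P * s)) q volume := by
    have hmap : MemLp f q (Measure.map (fun s => P * s) volume) := by
      rw [Real.map_volume_mul_left hP.ne']
      exact hf.smul_measure ENNReal.ofReal_ne_top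
    exact hmap.comp_of_map (measurable_const_mul P).aemeasurable
  have hmap : MemLp (fun s => f (P * s)) q (Measure.map (circleRep a) haarAddCircle) := by
    rw [map_circleRep]
    exact hdilated.restrict _
  exact hmap.comp_of_map (measurableEmbedding_circleRep a).measurable.aemeasurable

lemma exists_surjective_compLp_periodLift (c : ℝ) {T : Set UnitAddCircle} (hT : MeasurableSet T) :
    ∃ Z : Lp ℂ 2 (haarAddCircle : Measure UnitAddCircle) →L[ℂ]
        Lp ℂ 2 (volume.restrict (periodLift c P T)),
      (∀ g, Z g =ᵐ[volume.restrict (periodLift c P T)] fun t => g ((t / P : ℝ) : UnitAddCircle)) ∧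
        Function.Surjective Z := by
  have hS := measurableSet_periodLift c P hT
  obtain ⟨Z, hZ⟩ := exists_compLp_of_map_le_smul (𝕜 := ℂ) (E := ℂ) (q := 2) (by finiteness)
    (measurable_coe_div P) ENNReal.ofReal_ne_top (map_coe_div_restrict_periodLift_le (c := c) hP T)
  refine ⟨Z, hZ, fun F => ?_⟩
  obtain ⟨f, hf, hfF⟩ : ∃ f : ℝ → ℂ, MemLp f 2 volume ∧ ∀ t ∈ periodLift c P T, f t = F t :=
    ⟨_, (memLp_indicator_iff_restrict hS).2 (Lp.memLp F), fun _ ht => indicator_of_mem ht _⟩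
  have hfrep := memLp_comp_mul_circleRep hP hf (c / P)
  have hcoe := (ae_restrict_periodLift_iff (c := c) hP hT fun x =>
    hfrep.toLp (fun x => f (P * circleRep (c / P) x)) x = f (P * circleRep (c / P) x)).2
    (hfrep.coeFn_toLp.mono fun x hx _ => hx)
  refine ⟨hfrep.toLp, Lp.ext ?_⟩
  filter_upwards [hZ hfrep.toLp, hcoe, ae_restrict_mem hS] with t hZt hft ht
  rw [hZt, hft, circleRep_coe ((div_mem_Ioc_iff hP).2 ht.1), mul_div_cancel₀ _ hP.ne',
    hfF t ht]

theorem IsRieszSpectrum.isExpRieszBasis_periodLift {Λ : Set ℤ} {T : Set UnitAddCircle}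
    (hΛ : IsRieszSpectrum Λ T) (hT : MeasurableSet T) (c : ℝ) :
    IsExpRieszBasis ((fun k : ℤ => 2 * Real.pi / P * (k : ℝ)) '' Λ) (periodLift c P T) := by
  obtain ⟨Z, hZ, hsurj⟩ := exists_surjective_compLp_periodLift hP c hT
  have hae := ae_restrict_periodLift_iff (c := c) hP hT
  have hbij := hΛ.bijective (compLp_eq_zero_iff hae hZ) hsurj
  let Φ := ContinuousLinearEquiv.ofBijective (Z.comp (spectralSubspace Λ).subtypeL)
    (LinearMap.ker_eq_bot.2 hbij.1) (LinearMap.range_eq_top.2 hbij.2)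
  have hfreq : Function.Injective fun k : ℤ => 2 * Real.pi / P * (k : ℝ) :=
    (mul_right_injective₀ (by positivity)).comp Int.cast_injective
  let e := (Equiv.Set.image _ Λ hfreq).symm
  have he (l) : 2 * Real.pi / P * ((e l : ℤ) : ℝ) = l :=
    congrArg Subtype.val ((Equiv.Set.image _ Λ hfreq).apply_symm_apply l)
  obtain ⟨b, hb⟩ := exists_hilbertBasis_spectralSubspace (Λ := Λ) (fun l => (e l : ℤ))
    (Subtype.val_injective.comp e.injective)
    ((e.surjective.range_comp Subtype.val).trans Subtype.range_val) (fun _ => 1) (by simp)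
  refine ⟨fun l => Φ (b l), fun l => ?_, isRieszBasis_of_equiv b Φ⟩
  have hΦ : Φ (b l) = Z (fourierBasis (e l : ℤ)) := by
    change Z (b l : Lp ℂ 2 haarAddCircle) = _
    rw [hb, one_smul]
  have hfourier := (hae fun x => fourierBasis (T := 1) (e l) x = fourier (e l : ℤ) x).2
    ((fourierBasis_ae_eq (e l)).mono fun x hx _ => hx)
  dsimp only
  rw [hΦ]
  filter_upwards [hZ (fourierBasis (e l : ℤ)), hfourier] with t hZt hfouriert
  rw [hZt, hfouriert, fourier_coe_eq_fourierChar, Real.fourierChar_apply, ← he l]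
  congr 1
  push_cast
  ring

/-! ### Finite unions of intervals -/

lemma periodLift_arc_ae_eq {a b : ℝ} (hca : c ≤ a) (hbc : b ≤ c + P) :
    periodLift c P ((fun t : ℝ => (t : UnitAddCircle)) '' Ico (a / P) (b / P))
      =ᵐ[volume] Ico a b := by
  rw [eventuallyEq_set]
  filter_upwards [Measure.ae_ne volume c, Measure.ae_ne volume (c + P)] with t hc hc'
  have hsub : Ico (a / P) (b / P) ⊆ Ico (c / P) (c / P + 1) := by
    rw [div_add_one hP.ne']
    exact Ico_subset_Ico (by gcongr) (by gcongr)
  constructor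
  · rintro ⟨ht, s, hs, hst⟩
    have ht' : t / P ∈ Ico (c / P) (c / P + 1) := by
      rw [div_add_one hP.ne', div_mem_Ico_iff hP]
      exact ⟨ht.1.le, lt_of_le_of_ne ht.2 hc'⟩
    rw [(AddCircle.coe_eq_coe_iff_of_mem_Ico (hsub hs) ht').1 hst] at hs
    exact (div_mem_Ico_iff hP).1 hs
  · intro ht
    exact ⟨⟨lt_of_le_of_ne (hca.trans ht.1) hc.symm, ht.2.le.trans hbc⟩, t / P,
      (div_mem_Ico_iff hP).2 ht, rfl⟩

end PeriodLift

lemma exists_ae_eq_Ico_of_ordConnected {J : Set ℝ} (hJ : J.OrdConnected) {u v : ℝ} (huv : u ≤ v)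
    (hJs : J ⊆ Icc u v) :
    ∃ a b, u ≤ a ∧ a ≤ b ∧ b ≤ v ∧ J =ᵐ[volume] Ico a b := by
  rcases J.eq_empty_or_nonempty with rfl | hne
  · exact ⟨u, u, le_rfl, le_rfl, huv, by simp⟩
  · have hbelow : BddBelow J := ⟨u, fun x hx => (hJs hx).1⟩
    have habove : BddAbove J := ⟨v, fun x hx => (hJs hx).2⟩
    refine ⟨sInf J, sSup J, le_csInf hne fun x hx => (hJs hx).1,
      Real.sInf_le_sSup J hbelow habove, csSup_le hne fun x hx => (hJs hx).2, ?_⟩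
    have hIoo : Ioo (sInf J) (sSup J) ⊆ J := fun x hx => by
      obtain ⟨y, hy, hyx⟩ := (csInf_lt_iff hbelow hne).1 hx.1
      obtain ⟨z, hz, hxz⟩ := (lt_csSup_iff habove hne).1 hx.2
      exact hJ.out hy hz ⟨hyx.le, hxz.le⟩
    have hIcc : J ⊆ Icc (sInf J) (sSup J) :=
      fun x hx => ⟨csInf_le hbelow hx, le_csSup habove hx⟩
    exact (hIcc.eventuallyLE.trans Ico_ae_eq_Icc.symm.le).antisymm
      (Ioo_ae_eq_Ico.symm.le.trans hIoo.eventuallyLE)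

lemma IsExpRieszBasis.congr_set {Λ S S' : Set ℝ} (h : IsExpRieszBasis Λ S)
    (hS : S =ᵐ[volume] S') : IsExpRieszBasis Λ S' := by
  unfold IsExpRieszBasis at h ⊢
  rwa [← Measure.restrict_congr_set hS]

lemma IsFiniteUnionOfIntervals.exists_subset_Icc {S : Set ℝ} (hS : IsFiniteUnionOfIntervals S) :
    ∃ c P, 0 < P ∧ S ⊆ Icc c (c + P) := by
  obtain ⟨n, J, hJ, rfl⟩ := hS
  obtain ⟨r, hr⟩ := (Bornology.isBounded_iUnion.2 fun i => (hJ i).2).subset_closedBall 0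
  rw [Real.closedBall_eq_Icc] at hr
  exact ⟨0 - r, 2 * |r| + 1, by positivity,
    hr.trans (Icc_subset_Icc_right (by linarith [le_abs_self r]))⟩

theorem mainTheorem1_general {S : Set ℝ} (hS : IsFiniteUnionOfIntervals S) {c P : ℝ} (hP : 0 < P)
    (hSc : S ⊆ Icc c (c + P)) :
    ∃ Λ : Set ℤ, IsExpRieszBasis ((fun k : ℤ => 2 * Real.pi / P * (k : ℝ)) '' Λ) S := by
  obtain ⟨n, J, hJ, rfl⟩ := hS
  choose a b hca hab hbc hJab using fun i => exists_ae_eq_Ico_of_ordConnected (hJ i).1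
    (by linarith : c ≤ c + P) ((subset_iUnion J i).trans hSc)
  obtain ⟨L, hL⟩ := exists_isFloorSum_biUnion Finset.univ (a := fun i => a i / P)
    (b := fun i => b i / P) (fun i _ => by have := hab i; gcongr) fun i _ => by
      rw [div_add_one hP.ne']
      gcongr
      linarith [hca i, hbc i]
  obtain ⟨Λ, hΛ⟩ := exists_isRieszSpectrum_of_isFloorSum hL
  refine ⟨Λ, (hΛ.isExpRieszBasis_periodLift hP (measurableSet_of_isFloorSum hL) c).congr_set ?_⟩
  simp only [Finset.mem_univ, iUnion_true, periodLift_iUnion]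
  exact Filter.EventuallyEq.countable_iUnion fun i =>
    (periodLift_arc_ae_eq hP (hca i) (hbc i)).trans (hJab i).symm

theorem mainTheorem1 (S : Set ℝ) (hS : IsFiniteUnionOfIntervals S) :
    (∃ Λ : Set ℝ, IsExpRieszBasis Λ S) ∧
    (S ⊆ Set.Icc 0 (2 * Real.pi) →
      ∃ Λ : Set ℝ, Λ ⊆ Set.range ((↑) : ℤ → ℝ) ∧ IsExpRieszBasis Λ S) := by
  refine ⟨?_, fun hSπ => ?_⟩
  · obtain ⟨c, P, hP, hSc⟩ := hS.exists_subset_Icc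
    obtain ⟨Λ, hΛ⟩ := mainTheorem1_general hS hP hSc
    exact ⟨_, hΛ⟩
  · obtain ⟨Λ, hΛ⟩ := mainTheorem1_general hS (c := 0) Real.two_pi_pos (by rwa [zero_add])
    simp only [div_self Real.two_pi_pos.ne', one_mul] at hΛ
    exact ⟨_, image_subset_range _ _, hΛ⟩
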